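/- Let $\mathcal H=L^2(\mathbb C,e^{-|z|^2}dA(z))$, where $dA$ is Lebesgue measure, and let the Bargmann space $\mathcal B\subset\mathcal H$ be the closed subspace of entire functions. For a bounded measurable real function $W$ on $\mathbb C$, the Toeplitz operator $T_W$ on $\mathcal B$ is the bounded operator with $\langle T_Wu,v\rangle=\int_{\mathbb C}W u\bar v\,e^{-|z|^2}dA$ for $u,v\in\mathcal B$, that is, multiplication by $W$ followed by the orthogonal projection onto $\mathcal B$. For $\lambda>0$ let $n(\lambda,T_W)$ be the number of eigenvalues $\mu$ of $T_W$ with $|\mu|>\lambda$, counted with multiplicity. Let $1<p<q$ be real numbers and consider the radial symbol $$V(z)=e^{-r^{2p}+r^2}\sin(r^{2q}),\qquad r=|z|,$$ and $V_\pm=\max(\pm V,0)$. Then $T_V,T_{|V|},T_{V_+},T_{V_-}$ are compact and self-adjoint, their counting functions are finite for every $\lambda>0$, and $$\limsup_{\lambda\to0+}n(\lambda,T_V)\,\frac{\log|\log\lambda|}{|\log\lambda|}\le\frac{q}{q-1},$$ while, as $\lambda\to0+$, $$n(\lambda,T_{|V|})\sim n(\lambda,T_{V_+})\sim n(\lambda,T_{V_-})\sim\frac{p}{p-1}\,\frac{|\log\lambda|}{\log|\log\lambda|}.$$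 Here $f\sim g$ means $f/g\to1$. -/

import Mathlib

open MeasureTheory Filter Topology
open scoped ENNReal

noncomputable section

namespace Bargmann

/-- The Gaussian measure `e^{-|z|²} dA(z)` on `ℂ`, with `dA` the Lebesgue measure. -/
def gaussian : Measure ℂ :=
  volume.withDensity fun z => ENNReal.ofReal (Real.exp (-‖z‖ ^ 2))

/-- The Hilbert space `L²(ℂ, e^{-|z|²} dA)`. -/
abbrev L2 : Type := Lp ℂ 2 gaussian

/-- The complex Bargmann space: the elements of `L²(ℂ, e^{-|z|²} dA)` that have an entire
representative. -/
def space : Submodule ℂ L2 where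
  carrier := {f | ∃ g : ℂ → ℂ, Differentiable ℂ g ∧ f =ᵐ[gaussian] g}
  zero_mem' := ⟨fun _ => 0, differentiable_const 0, Lp.coeFn_zero ℂ 2 gaussian⟩
  add_mem' := by
    rintro f₁ f₂ ⟨g₁, hg₁, h₁⟩ ⟨g₂, hg₂, h₂⟩
    refine ⟨fun z => g₁ z + g₂ z, hg₁.add hg₂, ?_⟩
    filter_upwards [Lp.coeFn_add f₁ f₂, h₁, h₂] with z hz h₁z h₂z
    rw [hz, Pi.add_apply, h₁z, h₂z]
  smul_mem' := by
    rintro c f ⟨g, hg, h⟩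
    refine ⟨fun z => c * g z, hg.const_mul c, ?_⟩
    filter_upwards [Lp.coeFn_smul c f, h] with z hz hz'
    simp [hz, hz']

/-! ### The Bargmann space is closed in `L²`, so that it is a Hilbert space -/

/-- Mean value property on a circle, as an inequality. -/
theorem enorm_le_lintegral_circle {g : ℂ → ℂ} (hg : Differentiable ℂ g) (z : ℂ) (r : ℝ) :
    ENNReal.ofReal (2 * Real.pi) * ‖g z‖ₑ ≤
      ∫⁻ θ in Set.Ioo (-Real.pi) Real.pi, ‖g (circleMap z r θ)‖ₑ := by
  have h1 : Real.circleAverage g z r = g z :=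
    DiffContOnCl.circleAverage hg.diffContOnCl
  rw [Real.circleAverage_eq_integral_add (-Real.pi),
    intervalIntegral.integral_comp_add_right (fun θ => g (circleMap z r θ))] at h1
  have h2 : (∫ θ in (-Real.pi)..Real.pi, g (circleMap z r θ)) = (2 * Real.pi : ℝ) • g z := by
    rw [← h1, smul_smul, mul_inv_cancel₀ (by positivity), one_smul]
    congr 1 <;> ring
  have h3 : ‖(2 * Real.pi : ℝ) • g z‖ₑ = ENNReal.ofReal (2 * Real.pi) * ‖g z‖ₑ := by
    rw [enorm_smul, Real.enorm_eq_ofReal (by positivity)]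
  rw [← h3, ← h2, intervalIntegral.integral_of_le (by linarith [Real.pi_pos]),
    MeasureTheory.integral_Ioc_eq_integral_Ioo]
  exact enorm_integral_le_lintegral_enorm _

/-- Mean value property on a disc, as an inequality. -/
theorem enorm_le_lintegral_ball {g : ℂ → ℂ} (hg : Differentiable ℂ g) (z : ℂ) :
    ENNReal.ofReal Real.pi * ‖g z‖ₑ ≤ ∫⁻ w in Metric.ball z 1, ‖g w‖ₑ := by
  have hgc : Continuous g := hg.continuous
  set F : ℂ → ℝ≥0∞ := (Metric.ball z 1).indicator fun w => ‖g w‖ₑ with hF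
  have e1 : ∫⁻ w in Metric.ball z 1, ‖g w‖ₑ = ∫⁻ w, F (z + w) := by
    rw [lintegral_add_left_eq_self F z, hF, lintegral_indicator Metric.isOpen_ball.measurableSet]
  rw [e1, ← Complex.lintegral_comp_polarCoord_symm]
  have e2 : ∀ x : ℝ × ℝ, x ∈ Set.Ioo (0 : ℝ) 1 ×ˢ Set.Ioo (-Real.pi) Real.pi →
      ENNReal.ofReal x.1 * ‖g (circleMap z x.1 x.2)‖ₑ =
        ENNReal.ofReal x.1 • F (z + Complex.polarCoord.symm x) := by
    rintro ⟨r, θ⟩ ⟨⟨hr0, hr1⟩, -⟩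
    have h : z + Complex.polarCoord.symm (r, θ) = circleMap z r θ := by
      simp [circleMap, Complex.exp_mul_I]
    have hm : circleMap z r θ ∈ Metric.ball z 1 := by
      simpa [circleMap, abs_of_pos hr0] using hr1
    rw [h, hF, Set.indicator_of_mem hm, smul_eq_mul]
  have hsub : Set.Ioo (0 : ℝ) 1 ×ˢ Set.Ioo (-Real.pi) Real.pi ⊆ polarCoord.target := by
    rw [polarCoord_target]
    exact Set.prod_mono Set.Ioo_subset_Ioi_self le_rfl
  refine le_trans ?_ (lintegral_mono_set hsub)
  rw [← setLIntegral_congr_fun (measurableSet_Ioo.prod measurableSet_Ioo) e2,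
    Measure.volume_eq_prod, ← Measure.prod_restrict]
  have hcm : Continuous fun x : ℝ × ℝ => circleMap z x.1 x.2 := by
    unfold circleMap; fun_prop
  rw [lintegral_prod _ (by
    apply Measurable.aemeasurable
    exact (ENNReal.measurable_ofReal.comp measurable_fst).mul
      (hgc.comp hcm).enorm.measurable)]
  calc ENNReal.ofReal Real.pi * ‖g z‖ₑ
      = ∫⁻ r in Set.Ioo (0 : ℝ) 1,
          ENNReal.ofReal r * (ENNReal.ofReal (2 * Real.pi) * ‖g z‖ₑ) := by
        rw [lintegral_mul_const _ ENNReal.measurable_ofReal]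
        have : ∫⁻ r in Set.Ioo (0 : ℝ) 1, ENNReal.ofReal r = ENNReal.ofReal (1 / 2) := by
          rw [← ofReal_integral_eq_lintegral_ofReal]
          · rw [← MeasureTheory.integral_Ioc_eq_integral_Ioo,
              ← intervalIntegral.integral_of_le zero_le_one]
            simp
          · exact (continuous_id.integrableOn_Icc (a := (0 : ℝ)) (b := 1)).mono_set
              Set.Ioo_subset_Icc_self
          · exact (ae_restrict_iff' measurableSet_Ioo).2 (Eventually.of_forall fun r hr => hr.1.le)
        rw [this, ← mul_assoc, ← ENNReal.ofReal_mul (by norm_num)]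
        congr 2
        ring
    _ ≤ _ := by
        refine lintegral_mono fun r => ?_
        rw [lintegral_const_mul' _ _ ENNReal.ofReal_ne_top]
        gcongr
        exact enorm_le_lintegral_circle hg z r

/-- On compact sets, Lebesgue measure is dominated by a multiple of the Gaussian measure. -/
theorem lintegral_ball_le (h : ℂ → ℝ≥0∞) {z : ℂ} {R : ℝ} (hz : ‖z‖ ≤ R) :
    ∫⁻ w in Metric.ball z 1, h w ≤
      ENNReal.ofReal (Real.exp ((R + 1) ^ 2)) * ∫⁻ w, h w ∂gaussian := by
  have hd : Measurable fun z : ℂ => ENNReal.ofReal (Real.exp (-‖z‖ ^ 2)) := by fun_prop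
  rw [gaussian, lintegral_withDensity_eq_lintegral_mul_non_measurable _ hd
    (Eventually.of_forall fun z => ENNReal.ofReal_lt_top), ← lintegral_const_mul' _ _
    ENNReal.ofReal_ne_top]
  refine le_trans (setLIntegral_mono_ae' Metric.isOpen_ball.measurableSet
    (Eventually.of_forall fun w hw => ?_)) (setLIntegral_le_lintegral (Metric.ball z 1) _)
  have hw' : ‖w‖ ≤ R + 1 := by
    have h1 : ‖w - z‖ < 1 := by simpa [dist_eq_norm] using hw
    have h2 : ‖w‖ ≤ ‖w - z‖ + ‖z‖ := by simpa using norm_add_le (w - z) z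
    linarith
  have h1 : 1 ≤ Real.exp ((R + 1) ^ 2) * Real.exp (-‖w‖ ^ 2) := by
    rw [← Real.exp_add]
    apply Real.one_le_exp
    have : ‖w‖ ^ 2 ≤ (R + 1) ^ 2 := by gcongr
    linarith
  calc h w = 1 * h w := (one_mul _).symm
    _ ≤ ENNReal.ofReal (Real.exp ((R + 1) ^ 2) * Real.exp (-‖w‖ ^ 2)) * h w := by
        gcongr
        simpa using ENNReal.ofReal_le_ofReal h1
    _ = _ := by
        rw [ENNReal.ofReal_mul (Real.exp_pos _).le, mul_assoc]
        rfl

/-- Point evaluations are locally uniformly bounded by the `L²` norm. -/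
theorem enorm_le_of_entire {g : ℂ → ℂ} (hg : Differentiable ℂ g) {z : ℂ} {R : ℝ} (hz : ‖z‖ ≤ R) :
    ‖g z‖ₑ ^ 2 ≤ ENNReal.ofReal (Real.exp ((R + 1) ^ 2)) * eLpNorm g 2 gaussian ^ 2 := by
  have hπ : 1 ≤ ENNReal.ofReal Real.pi := by
    simpa using ENNReal.ofReal_le_ofReal (show (1 : ℝ) ≤ Real.pi by linarith [Real.pi_gt_three])
  have h1 := enorm_le_lintegral_ball (hg.pow 2) z
  have h2 : eLpNorm g 2 gaussian ^ 2 = ∫⁻ w, ‖g w‖ₑ ^ 2 ∂gaussian := by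
    have := eLpNorm_nnreal_pow_eq_lintegral (μ := gaussian) (f := g) (p := 2) (by norm_num)
    simpa using this
  rw [h2]
  calc ‖g z‖ₑ ^ 2 ≤ ENNReal.ofReal Real.pi * ‖g z‖ₑ ^ 2 := le_mul_of_one_le_left' hπ
    _ = ENNReal.ofReal Real.pi * ‖(g ^ 2) z‖ₑ := by simp [enorm_pow]
    _ ≤ ∫⁻ w in Metric.ball z 1, ‖(g ^ 2) w‖ₑ := h1
    _ = ∫⁻ w in Metric.ball z 1, ‖g w‖ₑ ^ 2 := by simp [enorm_pow]
    _ ≤ _ := lintegral_ball_le _ hz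

theorem dist_le_of_entire {f₁ f₂ : L2} {g₁ g₂ : ℂ → ℂ} (hg₁ : Differentiable ℂ g₁)
    (hg₂ : Differentiable ℂ g₂) (h₁ : f₁ =ᵐ[gaussian] g₁) (h₂ : f₂ =ᵐ[gaussian] g₂)
    {z : ℂ} {R : ℝ} (hz : ‖z‖ ≤ R) :
    dist (g₁ z) (g₂ z) ≤ Real.exp ((R + 1) ^ 2) * dist f₁ f₂ := by
  have h3 := enorm_le_of_entire (hg₁.sub hg₂) hz
  have h4 : eLpNorm (g₁ - g₂) 2 gaussian = ENNReal.ofReal (dist f₁ f₂) := by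
    rw [dist_eq_norm, ofReal_norm, Lp.enorm_def]
    refine eLpNorm_congr_ae ?_
    filter_upwards [Lp.coeFn_sub f₁ f₂, h₁, h₂] with w hw hw₁ hw₂
    rw [hw, Pi.sub_apply, Pi.sub_apply, hw₁, hw₂]
  have h5 : ‖(g₁ - g₂) z‖ₑ = ENNReal.ofReal (dist (g₁ z) (g₂ z)) := by
    rw [dist_eq_norm, ofReal_norm]
    rfl
  rw [h4, h5, ← ENNReal.ofReal_pow dist_nonneg, ← ENNReal.ofReal_pow dist_nonneg,
    ← ENNReal.ofReal_mul (Real.exp_pos _).le, ENNReal.ofReal_le_ofReal_iff (by positivity)] at h3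
  have hE : 1 ≤ Real.exp ((R + 1) ^ 2) := Real.one_le_exp (sq_nonneg _)
  refine le_of_sq_le_sq ?_ (by positivity)
  calc dist (g₁ z) (g₂ z) ^ 2 ≤ Real.exp ((R + 1) ^ 2) * dist f₁ f₂ ^ 2 := h3
    _ ≤ Real.exp ((R + 1) ^ 2) ^ 2 * dist f₁ f₂ ^ 2 := by
        gcongr
        nlinarith
    _ = _ := by ring

theorem isClosed_space : IsClosed (space : Set L2) := by
  refine IsSeqClosed.isClosed fun f F hf hF => ?_
  choose g hg hfg using hf
  have hC : ∀ z : ℂ, CauchySeq fun n => g n z := by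
    intro z
    rw [Metric.cauchySeq_iff']
    intro ε hε
    obtain ⟨N, hN⟩ := Metric.cauchySeq_iff'.1 hF.cauchySeq
      (ε / Real.exp ((‖z‖ + 1) ^ 2)) (by positivity)
    refine ⟨N, fun n hn => ?_⟩
    calc dist (g n z) (g N z) ≤ Real.exp ((‖z‖ + 1) ^ 2) * dist (f n) (f N) :=
          dist_le_of_entire (hg n) (hg N) (hfg n) (hfg N) le_rfl
      _ < Real.exp ((‖z‖ + 1) ^ 2) * (ε / Real.exp ((‖z‖ + 1) ^ 2)) := by
          gcongr
          exact hN n hn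
      _ = ε := by field_simp
  choose G hG using fun z => cauchySeq_tendsto_of_complete (hC z)
  have hbound : ∀ (R : ℝ) (z : ℂ), ‖z‖ ≤ R → ∀ n,
      dist (g n z) (G z) ≤ Real.exp ((R + 1) ^ 2) * dist (f n) F := by
    intro R z hz n
    refine le_of_tendsto_of_tendsto' (tendsto_const_nhds.dist (hG z))
      ((tendsto_const_nhds.dist hF).const_mul _) fun m => ?_
    exact dist_le_of_entire (hg n) (hg m) (hfg n) (hfg m) hz
  have hloc : TendstoLocallyUniformlyOn g G atTop Set.univ := by
    rw [Metric.tendstoLocallyUniformlyOn_iff]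
    intro ε hε z _
    refine ⟨Metric.ball z 1, mem_nhdsWithin_of_mem_nhds (Metric.ball_mem_nhds z one_pos), ?_⟩
    have h0 : Tendsto (fun n => Real.exp ((‖z‖ + 1 + 1) ^ 2) * dist (f n) F) atTop (𝓝 0) := by
      simpa using (tendsto_iff_dist_tendsto_zero.1 hF).const_mul (Real.exp ((‖z‖ + 1 + 1) ^ 2))
    filter_upwards [h0.eventually (gt_mem_nhds hε)] with n hn w hw
    have hw' : ‖w‖ ≤ ‖z‖ + 1 := by
      have h1 : ‖w - z‖ < 1 := by simpa [dist_eq_norm] using hw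
      have h2 : ‖w‖ ≤ ‖w - z‖ + ‖z‖ := by simpa using norm_add_le (w - z) z
      linarith
    rw [dist_comm]
    exact (hbound _ w hw' n).trans_lt hn
  have hGd : Differentiable ℂ G :=
    differentiableOn_univ.1 (hloc.differentiableOn
      (Eventually.of_forall fun n => (hg n).differentiableOn) isOpen_univ)
  refine ⟨G, hGd, ?_⟩
  have hm : TendstoInMeasure gaussian (fun n => (f n : ℂ → ℂ)) atTop F :=
    tendstoInMeasure_of_tendsto_Lp hF
  obtain ⟨ns, hns, hae⟩ := hm.exists_seq_tendsto_ae
  filter_upwards [hae, ae_all_iff.2 hfg] with z hz hz'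
  refine tendsto_nhds_unique hz ?_
  simp only [hz']
  exact (hG z).comp hns.tendsto_atTop

instance : CompleteSpace space := isClosed_space.completeSpace_coe

/-! ### Toeplitz operators -/

/-- Multiplication by a bounded real function `V`, as an operator in `L²`. -/
def mulOp (V : ℂ → ℝ) (hV : MemLp (fun z => (V z : ℂ)) ∞ gaussian) : L2 →L[ℂ] L2 :=
  (ContinuousLinearMap.mul ℂ ℂ).holderL gaussian ∞ 2 2 hV.toLp

/-- The Toeplitz operator with bounded real symbol `V` in the Bargmann space: multiplication by
`V` followed by the orthogonal projection onto the Bargmann space. -/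
def toeplitz (V : ℂ → ℝ) (hV : MemLp (fun z => (V z : ℂ)) ∞ gaussian) : space →L[ℂ] space :=
  space.orthogonalProjectionOnto ∘L mulOp V hV ∘L space.subtypeL

/-- The Toeplitz operator is the operator of the form `⟨V u, v⟩`. -/
theorem inner_toeplitz (V : ℂ → ℝ) (hV : MemLp (fun z => (V z : ℂ)) ∞ gaussian) (u v : space) :
    inner ℂ v (toeplitz V hV u) =
      ∫ z, (V z : ℂ) * ((u : L2) z * (starRingEnd ℂ) ((v : L2) z)) ∂gaussian := by
  have h1 : inner ℂ v (toeplitz V hV u) = inner ℂ (v : L2) (mulOp V hV u) := by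
    exact Submodule.inner_orthogonalProjectionOnto_eq_of_mem_left v _
  rw [h1, L2.inner_def]
  refine integral_congr_ae ?_
  filter_upwards [(ContinuousLinearMap.mul ℂ ℂ).coeFn_holder (r := 2) hV.toLp (u : L2),
    hV.coeFn_toLp] with z hz hz'
  have : (mulOp V hV u : ℂ → ℂ) z = (V z : ℂ) * (u : L2) z := by
    rw [← hz']
    exact hz
  simp [this, mul_assoc]

/-! ### Counting functions of eigenvalues -/

section Counting

variable {H : Type*} [NormedAddCommGroup H] [InnerProductSpace ℂ H]

/-- The multiplicity of the real number `x` as an eigenvalue of `T` (it is `0` if `x` is not an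
eigenvalue, and `⊤` if the eigenspace has infinite dimension). -/
def multiplicity (T : H →L[ℂ] H) (x : ℝ) : ℕ∞ :=
  Cardinal.toENat (Module.rank ℂ (Module.End.eigenspace (T : H →ₗ[ℂ] H) (x : ℂ)))

/-- `n₊(t)`: the number of eigenvalues `x` of `T` with `x > t`, counted with multiplicity. -/
def countPos (T : H →L[ℂ] H) (t : ℝ) : ℝ≥0∞ :=
  ∑' x : Set.Ioi t, (multiplicity T (x : ℝ) : ℝ≥0∞)

/-- `n₋(t)`: the number of eigenvalues `-x` of `T` with `x > t`, counted with multiplicity. -/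
def countNeg (T : H →L[ℂ] H) (t : ℝ) : ℝ≥0∞ :=
  ∑' x : Set.Ioi t, (multiplicity T (-(x : ℝ)) : ℝ≥0∞)

/-- `n(t) = n₊(t) + n₋(t)`; for a compact self-adjoint operator and `t > 0` this is the number of
singular numbers greater than `t`. -/
def count (T : H →L[ℂ] H) (t : ℝ) : ℝ≥0∞ := countPos T t + countNeg T t

end Counting

/-! ### The symbols -/

/-- The profile `e^{-r^{2p} + r²} sin (r^{2q})`, for `r ≥ 0`. -/
def profile (p q r : ℝ) : ℝ := Real.exp (-r ^ (2 * p) + r ^ 2) * Real.sin (r ^ (2 * q))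

/-- The radial symbol `V(|z|) = e^{-|z|^{2p} + |z|²} sin (|z|^{2q})`. -/
def symbol (p q : ℝ) (z : ℂ) : ℝ := profile p q ‖z‖

/-- `|V|`. -/
def symbolAbs (p q : ℝ) (z : ℂ) : ℝ := |symbol p q z|

/-- The positive part `V₊`. -/
def symbolPos (p q : ℝ) (z : ℂ) : ℝ := max (symbol p q z) 0

/-- The negative part `V₋` (so that `V = V₊ - V₋`). -/
def symbolNeg (p q : ℝ) (z : ℂ) : ℝ := max (-symbol p q z) 0

theorem measurable_symbol (p q : ℝ) : Measurable (symbol p q) := by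
  unfold symbol profile
  fun_prop

theorem abs_symbol_le {p : ℝ} (hp : 1 < p) (q : ℝ) (z : ℂ) : |symbol p q z| ≤ Real.exp 1 := by
  have hr : 0 ≤ ‖z‖ := norm_nonneg z
  have h : -‖z‖ ^ (2 * p) + ‖z‖ ^ 2 ≤ 1 := by
    rcases le_total ‖z‖ 1 with h1 | h1
    · have := Real.rpow_nonneg hr (2 * p)
      nlinarith
    · have := Real.rpow_le_rpow_of_exponent_le h1 (show (2 : ℝ) ≤ 2 * p by linarith)
      rw [Real.rpow_two] at this
      linarith
  rw [symbol, profile, abs_mul, abs_of_pos (Real.exp_pos _)]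
  calc _ ≤ Real.exp 1 * 1 := by
        gcongr
        exact Real.abs_sin_le_one _
    _ = _ := mul_one _

theorem memLp_of_bound {W : ℂ → ℝ} (hW : Measurable W) {C : ℝ} (hC : ∀ z, |W z| ≤ C) :
    MemLp (fun z => (W z : ℂ)) ∞ gaussian :=
  memLp_top_of_bound (Complex.measurable_ofReal.comp hW).aestronglyMeasurable C
    (Eventually.of_forall fun z => by simpa using hC z)

theorem memLp_symbol {p : ℝ} (hp : 1 < p) (q : ℝ) :
    MemLp (fun z => (symbol p q z : ℂ)) ∞ gaussian :=
  memLp_of_bound (measurable_symbol p q) (abs_symbol_le hp q)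

theorem memLp_symbolAbs {p : ℝ} (hp : 1 < p) (q : ℝ) :
    MemLp (fun z => (symbolAbs p q z : ℂ)) ∞ gaussian :=
  memLp_of_bound (measurable_symbol p q).abs fun z => by
    simpa [symbolAbs] using abs_symbol_le hp q z

theorem memLp_symbolPos {p : ℝ} (hp : 1 < p) (q : ℝ) :
    MemLp (fun z => (symbolPos p q z : ℂ)) ∞ gaussian :=
  memLp_of_bound ((measurable_symbol p q).max measurable_const) fun z => by
    rw [symbolPos, abs_of_nonneg (le_max_right _ _)]
    exact max_le ((le_abs_self _).trans (abs_symbol_le hp q z)) (Real.exp_pos 1).le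

theorem memLp_symbolNeg {p : ℝ} (hp : 1 < p) (q : ℝ) :
    MemLp (fun z => (symbolNeg p q z : ℂ)) ∞ gaussian :=
  memLp_of_bound ((measurable_symbol p q).neg.max measurable_const) fun z => by
    rw [symbolNeg, abs_of_nonneg (le_max_right _ _)]
    exact max_le ((neg_le_abs _).trans (abs_symbol_le hp q z)) (Real.exp_pos 1).le

end Bargmann

end

/-! ### Operators that are diagonal in a Hilbert basis -/

namespace HilbertBasis

variable {H : Type*} [NormedAddCommGroup H] [InnerProductSpace ℂ H]

theorem ext_inner (b : HilbertBasis ℕ ℂ H) {u v : H}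
    (h : ∀ n, inner ℂ (b n) u = inner ℂ (b n) v) : u = v := by
  apply b.repr.injective
  ext n
  simpa [b.repr_apply_apply] using h n

theorem norm_le_mul_of_inner_le (b : HilbertBasis ℕ ℂ H) {u v : H} {C : ℝ} (hC : 0 ≤ C)
    (h : ∀ n, ‖inner ℂ (b n) v‖ ≤ C * ‖inner ℂ (b n) u‖) : ‖v‖ ≤ C * ‖u‖ := by
  have h1 : ‖b.repr v‖ ≤ ‖(C : ℂ) • b.repr u‖ := by
    refine lp.norm_mono two_ne_zero fun n => ?_
    rw [lp.coeFn_smul, Pi.smul_apply, b.repr_apply_apply, b.repr_apply_apply, norm_smul,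
      Complex.norm_real, Real.norm_of_nonneg hC]
    exact h n
  rwa [norm_smul, Complex.norm_real, Real.norm_of_nonneg hC, b.repr.norm_map,
    b.repr.norm_map] at h1

theorem inner_eq_ite (b : HilbertBasis ℕ ℂ H) (n m : ℕ) :
    inner ℂ (b n) (b m) = if n = m then 1 else 0 :=
  orthonormal_iff_ite.1 b.orthonormal n m

variable {b : HilbertBasis ℕ ℂ H} {T : H →L[ℂ] H} {ν : ℕ → ℝ}

theorem isCompactOperator_of_diagonal [CompleteSpace H]
    (hT : ∀ n u, inner ℂ (b n) (T u) = ν n * inner ℂ (b n) u)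
    (hν : Tendsto ν atTop (𝓝 0)) : IsCompactOperator T := by
  set F : ℕ → H →L[ℂ] H := fun N =>
    ∑ n ∈ Finset.range N, (innerSL ℂ (b n)).smulRight ((ν n : ℂ) • b n) with hF
  have hFc : ∀ N, IsCompactOperator (F N) := by
    intro N
    refine (compactOperator (RingHom.id ℂ) H H).sum_mem fun n _ => ?_
    have h1 : IsCompactOperator (innerSL ℂ (b n)) :=
      isCompactOperator_of_locallyCompactSpace_dom (innerSL ℂ (b n))
    exact h1.clm_comp (ContinuousLinearMap.toSpanSingleton ℂ ((ν n : ℂ) • b n))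
  have hFi : ∀ N n u, inner ℂ (b n) (F N u) = if n < N then ν n * inner ℂ (b n) u else 0 := by
    intro N n u
    simp [hF, inner_eq_ite, mul_comm]
  refine isCompactOperator_of_tendsto (F := F) (l := atTop) ?_ (Eventually.of_forall hFc)
  rw [tendsto_iff_norm_sub_tendsto_zero, Metric.tendsto_atTop]
  intro ε hε
  obtain ⟨N₀, hN₀⟩ := Metric.tendsto_atTop.1 hν (ε / 2) (by positivity)
  refine ⟨N₀, fun N hN => ?_⟩
  rw [Real.dist_0_eq_abs, abs_of_nonneg (norm_nonneg _)]
  refine lt_of_le_of_lt (ContinuousLinearMap.opNorm_le_bound _ (by positivity) fun u =>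
    b.norm_le_mul_of_inner_le (by positivity) fun n => ?_) (half_lt_self hε)
  rw [sub_apply, inner_sub_right, hFi, hT]
  split_ifs with hn
  · simp only [sub_self, norm_zero]
    positivity
  · rw [zero_sub, norm_neg, norm_mul, Complex.norm_real]
    gcongr
    have := hN₀ n (by omega)
    rw [dist_zero_right] at this
    exact this.le

theorem eigenspace_eq_span
    (hT : ∀ n u, inner ℂ (b n) (T u) = ν n * inner ℂ (b n) u) {x : ℝ}
    (hx : {n | ν n = x}.Finite) :
    Module.End.eigenspace (T : H →ₗ[ℂ] H) (x : ℂ) =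
      Submodule.span ℂ (Set.range fun n : {n | ν n = x} => b n) := by
  apply le_antisymm
  · intro v hv
    have hv' : T v = (x : ℂ) • v := Module.End.mem_eigenspace_iff.1 hv
    have h0 : ∀ n, n ∉ hx.toFinset → b.repr v n • b n = 0 := by
      intro n hn
      have h1 := hT n v
      rw [hv', inner_smul_right] at h1
      have h2 : (x : ℂ) ≠ ν n := by
        rw [Set.Finite.mem_toFinset, Set.mem_ofPred_eq] at hn
        exact fun h => hn (by exact_mod_cast h.symm)
      have h3 : inner ℂ (b n) v = 0 := by
        by_contra h
        exact h2 (mul_right_cancel₀ h h1)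
      rw [b.repr_apply_apply, h3, zero_smul]
    rw [(b.hasSum_repr v).unique (hasSum_sum_of_ne_finset_zero h0)]
    refine Submodule.sum_mem _ fun n hn => Submodule.smul_mem _ _ (Submodule.subset_span ?_)
    exact ⟨⟨n, hx.mem_toFinset.1 hn⟩, rfl⟩
  · rw [Submodule.span_le]
    rintro _ ⟨⟨n, hn⟩, rfl⟩
    refine Module.End.mem_eigenspace_iff.2 (b.ext_inner fun m => ?_)
    rw [inner_smul_right]
    refine (hT m (b n)).trans ?_
    rcases eq_or_ne m n with rfl | h
    · rw [show ν m = x from hn]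
    · rw [b.inner_eq_ite, if_neg h, mul_zero, mul_zero]

theorem multiplicity_eq_encard
    (hT : ∀ n u, inner ℂ (b n) (T u) = ν n * inner ℂ (b n) u) {x : ℝ}
    (hx : {n | ν n = x}.Finite) : Bargmann.multiplicity T x = {n | ν n = x}.encard := by
  have hli : LinearIndependent ℂ fun n : {n | ν n = x} => b n :=
    b.orthonormal.linearIndependent.comp _ Subtype.val_injective
  rw [Bargmann.multiplicity, eigenspace_eq_span hT hx, rank_span hli]
  change (Set.range fun n : {n | ν n = x} => b n).encard = _
  rw [← Set.image_eq_range, b.orthonormal.linearIndependent.injective.encard_image]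

theorem count_eq_encard
    (hT : ∀ n u, inner ℂ (b n) (T u) = ν n * inner ℂ (b n) u)
    (hν : Tendsto ν atTop (𝓝 0)) {t : ℝ} (ht : 0 < t) :
    Bargmann.count T t = {n | t < |ν n|}.encard := by
  have hfin : ∀ x : ℝ, x ≠ 0 → {n | ν n = x}.Finite := by
    intro x hx
    have h := hν.eventually_ne hx.symm
    rw [← Nat.cofinite_eq_atTop] at h
    simpa using eventually_cofinite.1 h
  have key : ∀ f : ℝ → ℝ, (∀ x, f (f x) = x) → (∀ x, 0 < x → f x ≠ 0) →
      ∑' x : Set.Ioi t, (Bargmann.multiplicity T (f x) : ℝ≥0∞) =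
        ∑' n, if t < f (ν n) then (1 : ℝ≥0∞) else 0 := by
    intro f hf hf0
    calc ∑' x : Set.Ioi t, (Bargmann.multiplicity T (f x) : ℝ≥0∞)
        = ∑' x : Set.Ioi t, ∑' n, if ν n = f x then (1 : ℝ≥0∞) else 0 := by
          refine tsum_congr fun x => ?_
          rw [multiplicity_eq_encard hT (hfin _ (hf0 x (ht.trans x.2))), ← ENNReal.tsum_set_one,
            tsum_subtype {n | ν n = f x} fun _ => (1 : ℝ≥0∞)]
          rfl
      _ = ∑' n, ∑' x : Set.Ioi t, if ν n = f x then (1 : ℝ≥0∞) else 0 := ENNReal.tsum_comm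
      _ = _ := by
          refine tsum_congr fun n => ?_
          have hiff : ∀ x : ℝ, ν n = f x ↔ x = f (ν n) := fun x =>
            ⟨fun h => by rw [h, hf], fun h => by rw [h, hf]⟩
          simp only [hiff]
          split_ifs with h
          · rw [tsum_eq_single (⟨f (ν n), h⟩ : Set.Ioi t)]
            · simp
            · rintro ⟨x, hx⟩ hne
              rw [if_neg fun h' => hne (Subtype.ext h')]
          · refine ENNReal.tsum_eq_zero.2 fun x => if_neg fun h' => h ?_
            rw [← h']
            exact x.2
  have hpos := key id (fun _ => rfl) fun x hx => hx.ne'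
  have hneg := key Neg.neg neg_neg fun x hx => (neg_lt_zero.2 hx).ne
  rw [Bargmann.count, Bargmann.countPos, Bargmann.countNeg]
  simp only [id] at hpos
  rw [hpos, hneg, ← ENNReal.tsum_add, ← ENNReal.tsum_set_one,
    tsum_subtype {n | t < |ν n|} fun _ => (1 : ℝ≥0∞)]
  refine tsum_congr fun n => ?_
  simp only [Set.indicator_apply, Set.mem_ofPred_eq, lt_abs]
  by_cases h1 : t < ν n <;> by_cases h2 : t < -ν n
  · linarith
  all_goals simp [h1, h2]

theorem count_eq_ncard
    (hT : ∀ n u, inner ℂ (b n) (T u) = ν n * inner ℂ (b n) u)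
    (hν : Tendsto ν atTop (𝓝 0)) {t : ℝ} (ht : 0 < t) :
    Bargmann.count T t = ({n | t < |ν n|}.ncard : ℝ≥0∞) := by
  have hfin : {n | t < |ν n|}.Finite := by
    have h := (hν.abs).eventually (gt_mem_nhds (show |(0 : ℝ)| < t by simpa using ht))
    rw [← Nat.cofinite_eq_atTop] at h
    exact (eventually_cofinite.1 h).subset fun n hn => not_lt.2 (le_of_lt hn)
  rw [count_eq_encard hT hν ht, ← hfin.cast_ncard_eq]
  simp

end HilbertBasis

namespace Bargmann

/-! ### Integrals against the Gaussian measure in polar coordinates -/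

theorem measurable_gaussian_density :
    Measurable fun z : ℂ => ENNReal.ofReal (Real.exp (-‖z‖ ^ 2)) := by
  fun_prop

theorem integral_gaussian (f : ℂ → ℂ) :
    ∫ z, f z ∂gaussian = ∫ z, (Real.exp (-‖z‖ ^ 2) : ℂ) * f z := by
  rw [gaussian, integral_withDensity_eq_integral_toReal_smul measurable_gaussian_density
    (Eventually.of_forall fun _ => ENNReal.ofReal_lt_top)]
  refine integral_congr_ae (Eventually.of_forall fun z => ?_)
  simp [ENNReal.toReal_ofReal (Real.exp_pos _).le]

theorem integrable_gaussian_iff {f : ℂ → ℂ} :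
    Integrable f gaussian ↔ Integrable fun z => (Real.exp (-‖z‖ ^ 2) : ℂ) * f z := by
  rw [gaussian, integrable_withDensity_iff_integrable_smul' measurable_gaussian_density
    (Eventually.of_forall fun _ => ENNReal.ofReal_lt_top)]
  refine integrable_congr (Eventually.of_forall fun z => ?_)
  simp [ENNReal.toReal_ofReal (Real.exp_pos _).le]

theorem polarCoord_symm_eq_circleMap (x : ℝ × ℝ) :
    Complex.polarCoord.symm x = circleMap 0 x.1 x.2 := by
  simp [circleMap, Complex.exp_mul_I]

/-- Integration in polar coordinates as an iterated integral. -/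
theorem integral_eq_integral_polar {F : ℂ → ℂ} (hm : Measurable F) (hF : Integrable F) :
    ∫ z, F z = ∫ r in Set.Ioi (0 : ℝ), ∫ θ in Set.Ioo (-Real.pi) Real.pi,
      (r : ℂ) * F (circleMap 0 r θ) := by
  have hc : Continuous fun x : ℝ × ℝ => circleMap 0 x.1 x.2 := by
    unfold circleMap; fun_prop
  have hint : IntegrableOn (fun x : ℝ × ℝ => (x.1 : ℂ) * F (circleMap 0 x.1 x.2))
      (Set.Ioi (0 : ℝ) ×ˢ Set.Ioo (-Real.pi) Real.pi) (volume.prod volume) := by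
    refine ⟨Measurable.aestronglyMeasurable ?_, ?_⟩
    · exact (Complex.measurable_ofReal.comp measurable_fst).mul (hm.comp hc.measurable)
    · refine lt_of_le_of_lt (le_of_eq ?_) hF.2
      rw [← Complex.lintegral_comp_polarCoord_symm fun z => ‖F z‖ₑ]
      refine setLIntegral_congr_fun (measurableSet_Ioi.prod measurableSet_Ioo) fun x hx => ?_
      have hx0 : 0 ≤ x.1 := le_of_lt hx.1
      simp only [polarCoord_symm_eq_circleMap, smul_eq_mul, enorm_mul]
      rw [← ofReal_norm (x.1 : ℂ), Complex.norm_real, Real.norm_of_nonneg hx0]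
  rw [← Complex.integral_comp_polarCoord_symm, polarCoord_target, Measure.volume_eq_prod,
    ← setIntegral_prod _ hint]
  simp only [polarCoord_symm_eq_circleMap, Complex.real_smul]

/-- Cauchy's formula for the Taylor coefficients, as a Fourier coefficient on a circle. -/
theorem integral_circle_mul_conj_pow {g : ℂ → ℂ} (hg : Differentiable ℂ g) (n : ℕ) {r : ℝ}
    (hr : 0 < r) :
    ∫ θ in Set.Ioo (-Real.pi) Real.pi,
      g (circleMap 0 r θ) * (starRingEnd ℂ) (circleMap 0 r θ ^ n) =
        2 * Real.pi * (r : ℂ) ^ (2 * n) * (iteratedDeriv n g 0 / n.factorial) := by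
  have h1 := DiffContOnCl.circleIntegral_one_div_sub_center_pow_smul (c := 0) hr n
    (hg.diffContOnCl (s := Metric.ball 0 r))
  have hper : Function.Periodic (fun θ =>
      g (circleMap 0 r θ) * (starRingEnd ℂ) (circleMap 0 r θ ^ n)) (2 * Real.pi) := by
    intro θ
    simp only [periodic_circleMap 0 r θ]
  have h2 := hper.intervalIntegral_add_eq (-Real.pi) 0
  rw [show -Real.pi + 2 * Real.pi = Real.pi by ring, zero_add] at h2
  rw [← MeasureTheory.integral_Ioc_eq_integral_Ioo,
    ← intervalIntegral.integral_of_le (by linarith [Real.pi_pos]), h2]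
  rw [circleIntegral] at h1
  have h3 : ∀ θ : ℝ, deriv (circleMap 0 r) θ • ((1 / (circleMap 0 r θ - 0) ^ (n + 1)) •
      g (circleMap 0 r θ)) = (Complex.I / (r : ℂ) ^ (2 * n)) *
        (g (circleMap 0 r θ) * (starRingEnd ℂ) (circleMap 0 r θ ^ n)) := by
    intro θ
    have hz : circleMap 0 r θ ≠ 0 := circleMap_ne_center hr.ne'
    have hr' : (r : ℂ) ≠ 0 := by exact_mod_cast hr.ne'
    have hzz : circleMap 0 r θ * (starRingEnd ℂ) (circleMap 0 r θ) = (r : ℂ) ^ 2 := by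
      rw [Complex.mul_conj, Complex.normSq_eq_norm_sq]
      simp
    have hc : (starRingEnd ℂ) (circleMap 0 r θ) = (r : ℂ) ^ 2 / circleMap 0 r θ := by
      rw [eq_div_iff hz, mul_comm, hzz]
    rw [map_pow, hc, deriv_circleMap, smul_eq_mul, smul_eq_mul, sub_zero, div_pow, ← pow_mul]
    field_simp
    ring
  simp only [h3] at h1
  rw [intervalIntegral.integral_const_mul] at h1
  have hr' : (r : ℂ) ≠ 0 := by exact_mod_cast hr.ne'
  have hn : (n.factorial : ℂ) ≠ 0 := by exact_mod_cast n.factorial_ne_zero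
  rw [div_mul_eq_mul_div, div_eq_iff (pow_ne_zero _ hr'), smul_eq_mul] at h1
  have hI := Complex.I_ne_zero
  apply mul_left_cancel₀ hI
  rw [h1]
  ring

/-- The eigenvalue of the Toeplitz operator with symbol `w(|z|)` on the monomial `z ^ n`. -/
noncomputable def radialEigenvalue (w : ℝ → ℝ) (n : ℕ) : ℝ :=
  2 / n.factorial * ∫ r in Set.Ioi (0 : ℝ), w r * r ^ (2 * n + 1) * Real.exp (-r ^ 2)

theorem integral_radial_mul_conj_pow {w : ℝ → ℝ} (hw : Measurable w) {g : ℂ → ℂ}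
    (hg : Differentiable ℂ g) (n : ℕ)
    (hint : Integrable (fun z => (w ‖z‖ : ℂ) * (g z * (starRingEnd ℂ) (z ^ n))) gaussian) :
    ∫ z, (w ‖z‖ : ℂ) * (g z * (starRingEnd ℂ) (z ^ n)) ∂gaussian =
      Real.pi * iteratedDeriv n g 0 * radialEigenvalue w n := by
  have hm : Measurable fun z : ℂ => (Real.exp (-‖z‖ ^ 2) : ℂ) *
      ((w ‖z‖ : ℂ) * (g z * (starRingEnd ℂ) (z ^ n))) := by
    have h1 : Measurable fun z : ℂ => (w ‖z‖ : ℂ) :=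
      Complex.measurable_ofReal.comp (hw.comp measurable_norm)
    have h2 : Measurable fun z : ℂ => g z * (starRingEnd ℂ) (z ^ n) :=
      (hg.continuous.mul (Complex.continuous_conj.comp (continuous_pow n))).measurable
    have h3 : Measurable fun z : ℂ => (Real.exp (-‖z‖ ^ 2) : ℂ) := by fun_prop
    exact h3.mul (h1.mul h2)
  rw [integral_gaussian, integral_eq_integral_polar hm (integrable_gaussian_iff.1 hint)]
  have h1 : ∀ r ∈ Set.Ioi (0 : ℝ), (∫ θ in Set.Ioo (-Real.pi) Real.pi, (r : ℂ) *
      ((Real.exp (-‖circleMap 0 r θ‖ ^ 2) : ℂ) * ((w ‖circleMap 0 r θ‖ : ℂ) *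
        (g (circleMap 0 r θ) * (starRingEnd ℂ) (circleMap 0 r θ ^ n))))) =
      (2 * Real.pi * (iteratedDeriv n g 0 / n.factorial)) *
        ((w r * r ^ (2 * n + 1) * Real.exp (-r ^ 2) : ℝ) : ℂ) := by
    intro r hr
    have hr' : |r| = r := abs_of_pos hr
    simp only [norm_circleMap_zero, hr']
    rw [integral_const_mul, integral_const_mul, integral_const_mul,
      integral_circle_mul_conj_pow hg n hr]
    push_cast
    ring
  rw [setIntegral_congr_fun measurableSet_Ioi h1, integral_const_mul, integral_complex_ofReal,
    radialEigenvalue]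
  push_cast
  ring

theorem radialEigenvalue_one (n : ℕ) : radialEigenvalue (fun _ => 1) n = 1 := by
  have h := integral_rpow_mul_exp_neg_rpow (p := 2) (q := (2 * n + 1 : ℕ)) two_pos
    (neg_one_lt_zero.trans_le (Nat.cast_nonneg _))
  simp only [Real.rpow_natCast, Real.rpow_two] at h
  have h2 : (((2 * n + 1 : ℕ) : ℝ) + 1) / 2 = n + 1 := by push_cast; ring
  have hn : (n.factorial : ℝ) ≠ 0 := by exact_mod_cast n.factorial_ne_zero
  rw [h2, Real.Gamma_nat_eq_factorial] at h
  simp only [radialEigenvalue, one_mul]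
  rw [h]
  field_simp

/-! ### The orthonormal basis of monomials -/

theorem memLp_pow (n : ℕ) : MemLp (fun z : ℂ => z ^ n) 2 gaussian := by
  have hm : AEStronglyMeasurable (fun z : ℂ => z ^ n) gaussian :=
    (continuous_pow n).aestronglyMeasurable
  rw [memLp_two_iff_integrable_sq_norm hm]
  have h : ∫ z : ℂ, ‖z‖ ^ ((2 * n : ℕ) : ℝ) * Real.exp (-‖z‖ ^ (2 : ℝ)) ≠ 0 := by
    rw [Complex.integral_rpow_mul_exp_neg_rpow one_le_two]
    · have : 0 < Real.Gamma ((((2 * n : ℕ) : ℝ) + 2) / 2) := Real.Gamma_pos_of_pos (by positivity)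
      positivity
    · have : (0 : ℝ) ≤ (2 * n : ℕ) := Nat.cast_nonneg _
      linarith
  have h2 := Integrable.of_integral_ne_zero h
  simp only [Real.rpow_natCast, Real.rpow_two] at h2
  rw [gaussian, integrable_withDensity_iff_integrable_smul' measurable_gaussian_density
    (Eventually.of_forall fun _ => ENNReal.ofReal_lt_top)]
  refine h2.congr (Eventually.of_forall fun z => ?_)
  simp only [ENNReal.toReal_ofReal (Real.exp_pos _).le, smul_eq_mul, norm_pow]
  ring

/-- The monomial `z ^ n` as an element of the Bargmann space. -/
noncomputable def monomial (n : ℕ) : space :=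
  ⟨(memLp_pow n).toLp, fun z => z ^ n, differentiable_pow n, (memLp_pow n).coeFn_toLp⟩

theorem integrable_mul_conj_pow {w : ℂ → ℝ} (hw : MemLp (fun z => (w z : ℂ)) ∞ gaussian)
    (u : L2) (n : ℕ) :
    Integrable (fun z => (w z : ℂ) * (u z * (starRingEnd ℂ) (z ^ n))) gaussian := by
  have h1 : MemLp (fun z : ℂ => (starRingEnd ℂ) (z ^ n)) 2 gaussian := (memLp_pow n).star
  have h2 : Integrable (fun z => u z * (starRingEnd ℂ) (z ^ n)) gaussian :=
    (Lp.memLp u).integrable_mul h1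
  exact memLp_one_iff_integrable.1 ((memLp_one_iff_integrable.2 h2).mul' hw)

theorem inner_monomial_toeplitz {w : ℝ → ℝ} (hw : Measurable w)
    (hV : MemLp (fun z : ℂ => (w ‖z‖ : ℂ)) ∞ gaussian) (n : ℕ) (u : space) {g : ℂ → ℂ}
    (hg : Differentiable ℂ g) (hu : (u : L2) =ᵐ[gaussian] g) :
    inner ℂ (monomial n) (toeplitz (fun z => w ‖z‖) hV u) =
      Real.pi * iteratedDeriv n g 0 * radialEigenvalue w n := by
  have h : (fun z => (w ‖z‖ : ℂ) * ((u : L2) z * (starRingEnd ℂ) (z ^ n))) =ᵐ[gaussian]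
      fun z => (w ‖z‖ : ℂ) * (g z * (starRingEnd ℂ) (z ^ n)) := by
    filter_upwards [hu] with z hz
    rw [hz]
  rw [inner_toeplitz, ← integral_radial_mul_conj_pow hw hg n
    ((integrable_mul_conj_pow hV u n).congr h)]
  refine integral_congr_ae ?_
  filter_upwards [hu, (memLp_pow n).coeFn_toLp] with z hz hz'
  rw [hz, monomial, hz']

theorem inner_monomial (n : ℕ) (u : space) {g : ℂ → ℂ}
    (hg : Differentiable ℂ g) (hu : (u : L2) =ᵐ[gaussian] g) :
    inner ℂ (monomial n) u = Real.pi * iteratedDeriv n g 0 := by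
  have hone : MemLp (fun z : ℂ => (((fun _ => 1 : ℝ → ℝ) ‖z‖ : ℝ) : ℂ)) ∞ gaussian :=
    memLp_of_bound (W := fun _ => 1) measurable_const (C := 1) fun _ => by simp
  have h : (fun z => (((fun _ => 1 : ℝ → ℝ) ‖z‖ : ℝ) : ℂ) *
      ((u : L2) z * (starRingEnd ℂ) (z ^ n))) =ᵐ[gaussian]
      fun z => (((fun _ => 1 : ℝ → ℝ) ‖z‖ : ℝ) : ℂ) * (g z * (starRingEnd ℂ) (z ^ n)) := by
    filter_upwards [hu] with z hz
    rw [hz]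
  have h1 := integral_radial_mul_conj_pow measurable_const hg n
    ((integrable_mul_conj_pow hone u n).congr h)
  rw [radialEigenvalue_one, Complex.ofReal_one, mul_one] at h1
  rw [← h1, Submodule.coe_inner, L2.inner_def]
  refine integral_congr_ae ?_
  filter_upwards [hu, (memLp_pow n).coeFn_toLp] with z hz hz'
  simp [hz, monomial, hz']

theorem inner_monomial_monomial (n m : ℕ) :
    inner ℂ (monomial n) (monomial m) = if n = m then (Real.pi * m.factorial : ℂ) else 0 := by
  rw [inner_monomial n (monomial m) (differentiable_pow m) (memLp_pow m).coeFn_toLp,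
    iteratedDeriv_fun_pow_zero]
  split_ifs <;> simp

/-- The normalized monomial `z ^ n / √(π n!)`. -/
noncomputable def unitMonomial (n : ℕ) : space :=
  (((√(Real.pi * n.factorial))⁻¹ : ℝ) : ℂ) • monomial n

theorem orthonormal_unitMonomial : Orthonormal ℂ unitMonomial := by
  rw [orthonormal_iff_ite]
  intro n m
  rw [unitMonomial, unitMonomial, inner_smul_left (𝕜 := ℂ) (E := space),
    inner_smul_right (𝕜 := ℂ) (E := space), inner_monomial_monomial,
    Complex.conj_ofReal]
  split_ifs with h
  · subst h
    have hpos : 0 < Real.pi * n.factorial := by positivity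
    have h1 : (√(Real.pi * n.factorial))⁻¹ * ((√(Real.pi * n.factorial))⁻¹ *
        (Real.pi * n.factorial)) = 1 := by
      rw [← mul_assoc, ← mul_inv, Real.mul_self_sqrt hpos.le, inv_mul_cancel₀ hpos.ne']
    exact_mod_cast h1
  · simp

theorem eq_zero_of_inner_monomial {u : space} (h : ∀ n, inner ℂ (monomial n) u = 0) : u = 0 := by
  obtain ⟨g, hg, hu⟩ := u.2
  have hπ : (Real.pi : ℂ) ≠ 0 := by exact_mod_cast Real.pi_ne_zero
  have h0 : ∀ n, iteratedDeriv n g 0 = 0 := fun n => by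
    have h1 := h n
    rw [inner_monomial n u hg hu] at h1
    exact (mul_eq_zero.1 h1).resolve_left hπ
  have hg0 : ∀ z, g z = 0 := fun z => by
    rw [← Complex.taylorSeries_eq_of_entire hg 0 z]
    simp [h0]
  refine Subtype.ext (Lp.ext ?_)
  filter_upwards [hu, Lp.coeFn_zero ℂ 2 gaussian] with z hz hz'
  rw [hz, hg0]
  exact hz'.symm

/-- The Hilbert basis of normalized monomials. -/
noncomputable def monomialBasis : HilbertBasis ℕ ℂ space :=
  HilbertBasis.mkOfOrthogonalEqBot orthonormal_unitMonomial <| by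
    rw [Submodule.eq_bot_iff]
    intro u hu
    refine eq_zero_of_inner_monomial fun n => ?_
    have h1 := hu (unitMonomial n) (Submodule.subset_span ⟨n, rfl⟩)
    rw [unitMonomial, inner_smul_left (𝕜 := ℂ) (E := space), Complex.conj_ofReal] at h1
    refine (mul_eq_zero.1 h1).resolve_left ?_
    have hpos : 0 < Real.pi * n.factorial := by positivity
    exact_mod_cast (inv_pos.2 (Real.sqrt_pos.2 hpos)).ne'

theorem inner_monomialBasis_toeplitz {w : ℝ → ℝ} (hw : Measurable w)
    (hV : MemLp (fun z : ℂ => (w ‖z‖ : ℂ)) ∞ gaussian) (n : ℕ) (u : space) :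
    inner ℂ (monomialBasis n) (toeplitz (fun z => w ‖z‖) hV u) =
      radialEigenvalue w n * inner ℂ (monomialBasis n) u := by
  obtain ⟨g, hg, hu⟩ := u.2
  rw [monomialBasis, HilbertBasis.coe_mkOfOrthogonalEqBot, unitMonomial,
    inner_smul_left (𝕜 := ℂ) (E := space), inner_smul_left (𝕜 := ℂ) (E := space),
    inner_monomial_toeplitz hw hV n u hg hu, inner_monomial n u hg hu]
  ring

theorem isSelfAdjoint_toeplitz (V : ℂ → ℝ) (hV : MemLp (fun z => (V z : ℂ)) ∞ gaussian) :
    IsSelfAdjoint (toeplitz V hV) := by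
  rw [ContinuousLinearMap.isSelfAdjoint_iff_isSymmetric]
  intro u v
  change inner ℂ (toeplitz V hV u) v = inner ℂ u (toeplitz V hV v)
  rw [← inner_conj_symm (𝕜 := ℂ) (E := space), inner_toeplitz, inner_toeplitz, ← integral_conj]
  refine integral_congr_ae (Eventually.of_forall fun z => ?_)
  simp only [map_mul, Complex.conj_ofReal, Complex.conj_conj]
  ring

/-! ### Integrals of `e^{b x - c e^{a x}}` -/

theorem mul_sub_exp_le {a b c : ℝ} (ha : 0 < a) (hb : 0 < b) (hc : 0 < c) (x : ℝ) :
    b * x - c * Real.exp (a * x) ≤ b / a * Real.log (b / (a * c)) := by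
  have hk : 0 < b / (a * c) := by positivity
  have h := Real.add_one_le_exp (a * x - Real.log (b / (a * c)))
  rw [Real.exp_sub, Real.exp_log hk, div_div_eq_mul_div, le_div_iff₀ hb] at h
  have h2 : b / a * (a * x - Real.log (b / (a * c)) + 1) ≤ c * Real.exp (a * x) := by
    rw [div_mul_eq_mul_div, div_le_iff₀ ha]
    linarith
  have h3 : b / a * (a * x - Real.log (b / (a * c)) + 1) =
      b * x - b / a * Real.log (b / (a * c)) + b / a := by
    field_simp
  have h4 : 0 < b / a := by positivity
  linarith

theorem integrable_exp_mul_sub_exp {a b c : ℝ} (ha : 0 < a) (hb : 0 < b) (hc : 0 < c) :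
    Integrable fun x : ℝ => Real.exp (b * x - c * Real.exp (a * x)) := by
  have h1 := integrableOn_rpow_mul_exp_neg_mul_rpow (p := a) (s := b - 1) (b := c)
    (by linarith) ha hc
  rw [← Real.range_exp, ← Set.image_univ, integrableOn_image_iff_integrableOn_abs_deriv_smul
    MeasurableSet.univ (fun x _ => (Real.hasDerivAt_exp x).hasDerivWithinAt)
    Real.exp_injective.injOn, integrableOn_univ] at h1
  refine h1.congr (Eventually.of_forall fun x => ?_)
  simp only [abs_of_pos (Real.exp_pos x), smul_eq_mul, ← Real.exp_mul, ← Real.exp_add]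
  congr 1
  rw [mul_comm x a]
  ring

theorem integral_exp_le {a : ℝ} (ha : 0 < a) {n : ℕ} (hn : 1 ≤ n) :
    ∫ x : ℝ, Real.exp ((n + 1) * x - Real.exp (a * x)) ≤
      (∫ x : ℝ, Real.exp (1 * x - 1 / 2 * Real.exp (a * x))) *
        Real.exp (n / a * Real.log (n / (a * (1 / 2)))) := by
  have hn' : (0 : ℝ) < n := by exact_mod_cast hn
  rw [← integral_mul_const]
  have h1 := integrable_exp_mul_sub_exp (b := (n : ℝ) + 1) ha (by positivity) one_pos
  simp only [one_mul] at h1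
  refine integral_mono h1
    ((integrable_exp_mul_sub_exp ha one_pos (by norm_num)).mul_const _) fun x => ?_
  simp only
  rw [← Real.exp_add, Real.exp_le_exp]
  have := mul_sub_exp_le ha hn' (show (0 : ℝ) < 1 / 2 by norm_num) x
  linarith

theorem tendsto_exp_mul_sub_exp_atTop {a b c : ℝ} (ha : 0 < a) (hb : 0 < b) (hc : 0 < c) :
    Tendsto (fun x : ℝ => Real.exp (b * x - c * Real.exp (a * x))) atTop (𝓝 0) := by
  refine Real.tendsto_exp_atBot.comp (tendsto_atBot_mono (fun x => ?_)
    (tendsto_atBot_add_const_left _ ((b + 1) / a * Real.log ((b + 1) / (a * c)))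
      tendsto_neg_atTop_atBot))
  have := mul_sub_exp_le ha (show 0 < b + 1 by linarith) hc x
  linarith

theorem tendsto_exp_mul_sub_exp_atBot {a b c : ℝ} (hb : 0 < b) (hc : 0 < c) :
    Tendsto (fun x : ℝ => Real.exp (b * x - c * Real.exp (a * x))) atBot (𝓝 0) := by
  refine Real.tendsto_exp_atBot.comp (tendsto_atBot_mono (fun x => ?_)
    (tendsto_id.const_mul_atBot hb))
  have := mul_pos hc (Real.exp_pos (a * x))
  simp only [id]
  linarith

/-- Shifting the line of integration of an entire function that is dominated on a strip. -/
theorem integral_shift_eq {f : ℂ → ℂ} (hf : Differentiable ℂ f) {θ : ℝ} (hθ : 0 ≤ θ) {B : ℝ → ℝ}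
    (hB : Integrable B) (hB₁ : Tendsto B atTop (𝓝 0)) (hB₂ : Tendsto B atBot (𝓝 0))
    (hfB : ∀ x y : ℝ, 0 ≤ y → y ≤ θ → ‖f (x + y * Complex.I)‖ ≤ B x) :
    ∫ x : ℝ, f x = ∫ x : ℝ, f (x + θ * Complex.I) := by
  have hc : ∀ y : ℝ, Continuous fun x : ℝ => f (x + y * Complex.I) := fun y =>
    hf.continuous.comp (by fun_prop)
  have hint : ∀ y : ℝ, 0 ≤ y → y ≤ θ → Integrable fun x : ℝ => f (x + y * Complex.I) :=
    fun y h0 h1 => hB.mono' (hc y).aestronglyMeasurable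
      (Eventually.of_forall fun x => hfB x y h0 h1)
  have hi0 : Integrable fun x : ℝ => f x := by simpa using hint 0 le_rfl hθ
  have hT : ∀ {l : Filter ℝ} {u : ℝ → ℝ}, Tendsto (fun R => B (u R)) l (𝓝 0) →
      Tendsto (fun R : ℝ => ∫ y in (0 : ℝ)..θ, f (u R + y * Complex.I)) l (𝓝 0) := by
    intro l u hu
    refine squeeze_zero_norm (a := fun R => B (u R) * |θ - 0|) (fun R => ?_)
      (by simpa using hu.mul_const |θ - 0|)
    refine intervalIntegral.norm_integral_le_of_norm_le_const fun y hy => ?_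
    rw [Set.uIoc_of_le hθ] at hy
    exact hfB _ y hy.1.le hy.2
  have h1 := intervalIntegral_tendsto_integral hi0 tendsto_neg_atTop_atBot
    (tendsto_id (α := ℝ) (x := atTop))
  have h2 := intervalIntegral_tendsto_integral (hint θ hθ le_rfl) tendsto_neg_atTop_atBot
    (tendsto_id (α := ℝ) (x := atTop))
  have h3 := hT (u := fun R => R) hB₁
  have h4 := hT (u := fun R => -R) (hB₂.comp tendsto_neg_atTop_atBot)
  have h5 := ((h1.sub h2).add (h3.const_smul Complex.I)).sub (h4.const_smul Complex.I)
  have h6 : ∀ R : ℝ, (∫ x in -R..id R, f x) - (∫ x in -R..id R, f (x + θ * Complex.I)) +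
      Complex.I • (∫ y in (0 : ℝ)..θ, f (R + y * Complex.I)) -
      Complex.I • (∫ y in (0 : ℝ)..θ, f ((-R : ℝ) + y * Complex.I)) = 0 := by
    intro R
    have := Complex.integral_boundary_rect_eq_zero_of_differentiableOn f (-R : ℂ)
      (R + θ * Complex.I) hf.differentiableOn
    simpa using this
  simp only [h6, smul_zero, add_zero, sub_zero] at h5
  exact sub_eq_zero.1 (tendsto_nhds_unique h5 tendsto_const_nhds)

/-- Cancellation: the oscillating integral is as small as if `e^{-e^{p x}}` were replaced
by `e^{-e^{q x}}`. -/
theorem abs_integral_exp_mul_sin_le {p q b : ℝ} (hp : 0 < p) (hpq : p < q) (hb : 0 < b) :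
    |∫ x : ℝ, Real.exp (b * x - Real.exp (p * x)) * Real.sin (Real.exp (q * x))| ≤
      ∫ x : ℝ, Real.exp (b * x - Real.exp (q * x)) := by
  have hq : 0 < q := hp.trans hpq
  set θ : ℝ := Real.pi / (2 * q) with hθ
  have hθ0 : 0 < θ := by positivity
  have hqθ : q * θ = Real.pi / 2 := by rw [hθ]; field_simp
  have hpθ : p * θ < Real.pi / 2 := by
    rw [← hqθ]
    gcongr
  set f : ℂ → ℂ := fun w => Complex.exp (b * w - Complex.exp (p * w) +
    Complex.I * Complex.exp (q * w)) with hf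
  have hnorm : ∀ x y : ℝ, ‖f (x + y * Complex.I)‖ = Real.exp (b * x -
      Real.exp (p * x) * Real.cos (p * y) - Real.exp (q * x) * Real.sin (q * y)) := by
    intro x y
    rw [hf, Complex.norm_exp]
    congr 1
    simp [Complex.exp_re, Complex.exp_im]
    ring
  have hcos : 0 < Real.cos (p * θ) :=
    Real.cos_pos_of_mem_Ioo ⟨by have := mul_pos hp hθ0; linarith [Real.pi_pos], hpθ⟩
  have hshift : ∫ x : ℝ, f x = ∫ x : ℝ, f (x + θ * Complex.I) := by
    refine integral_shift_eq (by rw [hf]; fun_prop) hθ0.le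
      (B := fun x => Real.exp (b * x - Real.cos (p * θ) * Real.exp (p * x)))
      (integrable_exp_mul_sub_exp hp hb hcos) (tendsto_exp_mul_sub_exp_atTop hp hb hcos)
      (tendsto_exp_mul_sub_exp_atBot hb hcos) fun x y hy0 hy1 => ?_
    rw [hnorm, Real.exp_le_exp]
    have h1 : Real.cos (p * θ) ≤ Real.cos (p * y) :=
      Real.cos_le_cos_of_nonneg_of_le_pi (by positivity) (by linarith [Real.pi_pos]) (by gcongr)
    have h2 : 0 ≤ Real.sin (q * y) := by
      refine Real.sin_nonneg_of_nonneg_of_le_pi (by positivity) ?_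
      have : q * y ≤ q * θ := by gcongr
      linarith [Real.pi_pos]
    have h3 := mul_nonneg (Real.exp_pos (q * x)).le h2
    have h4 := mul_le_mul_of_nonneg_left h1 (Real.exp_pos (p * x)).le
    linarith
  have hint : Integrable fun x : ℝ => f x := by
    have h1 := integrable_exp_mul_sub_exp hp hb one_pos
    refine h1.mono' (by rw [hf]; exact Continuous.aestronglyMeasurable (by fun_prop))
      (Eventually.of_forall fun x => ?_)
    have h2 := hnorm x 0
    simp only [Complex.ofReal_zero, zero_mul, add_zero, mul_zero, Real.cos_zero, Real.sin_zero,
      mul_one, sub_zero] at h2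
    rw [h2, one_mul]
  have him : ∫ x : ℝ, Real.exp (b * x - Real.exp (p * x)) * Real.sin (Real.exp (q * x)) =
      (∫ x : ℝ, f x).im := by
    have h1 := integral_im (𝕜 := ℂ) hint
    rw [← RCLike.im_eq_complex_im, ← h1]
    refine integral_congr_ae (Eventually.of_forall fun x => ?_)
    have h2 : f x = Complex.exp (((b * x - Real.exp (p * x) : ℝ) : ℂ) +
        (Real.exp (q * x) : ℝ) * Complex.I) := by
      rw [hf]
      push_cast
      congr 1
      ring
    simp only [h2, RCLike.im_eq_complex_im]
    generalize Real.exp (q * x) = s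
    generalize b * x - Real.exp (p * x) = t
    simp [Complex.exp_im]
  rw [him, hshift]
  refine (Complex.abs_im_le_norm _).trans ?_
  refine norm_integral_le_of_norm_le ?_ (Eventually.of_forall fun x => ?_)
  · simpa using integrable_exp_mul_sub_exp hq hb one_pos
  · rw [hnorm, Real.exp_le_exp, hqθ, Real.sin_pi_div_two]
    have : 0 ≤ Real.exp (p * x) * Real.cos (p * θ) := by positivity
    linarith

/-! ### The eigenvalues for the symbols `e^{-r^{2p} + r²} s(r^{2q})` -/

/-- The profile `e^{-r^{2p} + r²} s(r^{2q})`. -/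
noncomputable def modulatedProfile (p q : ℝ) (s : ℝ → ℝ) (r : ℝ) : ℝ :=
  Real.exp (-r ^ (2 * p) + r ^ 2) * s (r ^ (2 * q))

theorem measurable_modulatedProfile (p q : ℝ) {s : ℝ → ℝ} (hs : Measurable s) :
    Measurable (modulatedProfile p q s) := by
  unfold modulatedProfile
  fun_prop

theorem radialEigenvalue_modulatedProfile (p q : ℝ) (s : ℝ → ℝ) (n : ℕ) :
    radialEigenvalue (modulatedProfile p q s) n = (n.factorial : ℝ)⁻¹ *
      ∫ x : ℝ, Real.exp ((n + 1) * x - Real.exp (p * x)) * s (Real.exp (q * x)) := by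
  have himg : (fun x : ℝ => Real.exp (x / 2)) '' Set.univ = Set.Ioi 0 := by
    have hsurj : Function.Surjective fun x : ℝ => x / 2 := fun y => ⟨y * 2, by simp⟩
    rw [Set.image_univ, ← Real.range_exp]
    exact hsurj.range_comp Real.exp
  have hder : ∀ x ∈ Set.univ, HasDerivWithinAt (fun x : ℝ => Real.exp (x / 2))
      (Real.exp (x / 2) * (1 / 2)) Set.univ x := fun x _ =>
    (((hasDerivAt_id x).div_const 2).exp).hasDerivWithinAt
  have hinj : Set.InjOn (fun x : ℝ => Real.exp (x / 2)) Set.univ := fun x _ y _ h => by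
    have := Real.exp_injective h
    linarith
  rw [radialEigenvalue, ← himg,
    integral_image_eq_integral_abs_deriv_smul MeasurableSet.univ hder hinj, setIntegral_univ,
    div_eq_mul_inv, mul_comm (2 : ℝ), mul_assoc, ← integral_const_mul]
  congr 1
  refine integral_congr_ae (Eventually.of_forall fun x => ?_)
  have h1 : |Real.exp (x / 2) * (1 / 2)| = Real.exp (x / 2) * (1 / 2) :=
    abs_of_pos (by positivity)
  have h2 : ∀ a : ℝ, Real.exp (x / 2) ^ (2 * a) = Real.exp (a * x) := fun a => by
    rw [← Real.exp_mul]
    congr 1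
    ring
  have h3 : Real.exp (x / 2) ^ (2 * n + 1) = Real.exp (n * x + x / 2) := by
    rw [← Real.exp_nat_mul]
    congr 1
    push_cast
    ring
  simp only [modulatedProfile, h1, h2, h3, smul_eq_mul]
  have h4 : Real.exp ((n + 1) * x - Real.exp (p * x)) = Real.exp (x / 2) *
      (Real.exp (-Real.exp (p * x) + Real.exp (x / 2) ^ 2) * Real.exp (n * x + x / 2) *
        Real.exp (-Real.exp (x / 2) ^ 2)) := by
    rw [← Real.exp_add, ← Real.exp_add, ← Real.exp_add]
    congr 1
    ring
  rw [h4]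
  ring

theorem integrable_exp_mul_comp_exp {p b : ℝ} (q : ℝ) (hp : 0 < p) (hb : 0 < b) {s : ℝ → ℝ}
    (hs : Measurable s) (hs₁ : ∀ y, |s y| ≤ 1) :
    Integrable fun x : ℝ => Real.exp (b * x - Real.exp (p * x)) * s (Real.exp (q * x)) := by
  have h1 := integrable_exp_mul_sub_exp hp hb one_pos
  simp only [one_mul] at h1
  refine h1.mul_bdd (c := 1) (Measurable.aestronglyMeasurable (by fun_prop))
    (Eventually.of_forall fun x => hs₁ _)

theorem abs_integral_exp_mul_comp_exp_le {p b : ℝ} (q : ℝ) (hp : 0 < p) (hb : 0 < b)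
    {s : ℝ → ℝ} (hs₁ : ∀ y, |s y| ≤ 1) :
    |∫ x : ℝ, Real.exp (b * x - Real.exp (p * x)) * s (Real.exp (q * x))| ≤
      ∫ x : ℝ, Real.exp (b * x - Real.exp (p * x)) := by
  have h1 := integrable_exp_mul_sub_exp hp hb one_pos
  simp only [one_mul] at h1
  refine norm_integral_le_of_norm_le (f := fun x : ℝ =>
    Real.exp (b * x - Real.exp (p * x)) * s (Real.exp (q * x))) h1
    (Eventually.of_forall fun x => ?_)
  rw [norm_mul, Real.norm_of_nonneg (Real.exp_pos _).le]
  exact mul_le_of_le_one_right (Real.exp_pos _).le (hs₁ _)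

/-- Without cancellation: lower bound by the contribution of a single half-wave. -/
theorem le_integral_exp_mul_comp_exp {p q φ : ℝ} (hp : 0 < p) (hpq : p < q) (hφ : 0 ≤ φ)
    (hφ' : φ ≤ Real.pi) {s : ℝ → ℝ} (hs : Measurable s) (hs₀ : ∀ y, 0 ≤ s y) (hs₁ : ∀ y, s y ≤ 1)
    (hs₂ : ∀ (k : ℕ) (y : ℝ), 2 * Real.pi * k + φ + Real.pi / 6 ≤ y →
      y ≤ 2 * Real.pi * k + φ + 5 * Real.pi / 6 → 1 / 2 ≤ s y) {n : ℕ} (hn : 1 ≤ n) :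
    Real.exp (n / p * Real.log n - (1 + 4 * Real.pi) * n) * (1 / 2) *
        (1 / (q * ((1 + 4 * Real.pi) * Real.exp (q / p * Real.log n)))) ≤
      ∫ x : ℝ, Real.exp ((n + 1) * x - Real.exp (p * x)) * s (Real.exp (q * x)) := by
  have hq : 0 < q := hp.trans hpq
  have hπ := Real.pi_gt_three
  set D : ℝ := 1 + 4 * Real.pi with hD
  have hD1 : 1 ≤ D := by linarith
  have hn' : (1 : ℝ) ≤ n := by exact_mod_cast hn
  have hlog : 0 ≤ Real.log n := Real.log_nonneg hn'
  set Y : ℝ := Real.exp (q / p * Real.log n) with hY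
  have hY1 : 1 ≤ Y := Real.one_le_exp (by positivity)
  set k : ℕ := ⌈Y / (2 * Real.pi)⌉₊ with hk
  have hk1 : Y ≤ 2 * Real.pi * k := by
    have := Nat.le_ceil (Y / (2 * Real.pi))
    rwa [div_le_iff₀' (by positivity)] at this
  have hk2 : 2 * Real.pi * k ≤ Y + 2 * Real.pi := by
    have := (Nat.ceil_lt_add_one (show 0 ≤ Y / (2 * Real.pi) by positivity)).le
    rw [div_add_one (by positivity), le_div_iff₀' (by positivity)] at this
    exact this
  set A : ℝ := 2 * Real.pi * k + φ + Real.pi / 6 with hA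
  set E : ℝ := 2 * Real.pi * k + φ + 5 * Real.pi / 6 with hE
  have hYA : Y ≤ A := by linarith
  have hA0 : 0 < A := by linarith
  have hAE : 1 ≤ E - A := by linarith
  have hE0 : 0 < E := by linarith
  have hED : E ≤ D * Y := by nlinarith
  have hlen : 1 / (q * (D * Y)) ≤ Real.log E / q - Real.log A / q := by
    have h1 : 1 - A / E ≤ Real.log (E / A) := by
      have := Real.one_sub_inv_le_log_of_pos (show 0 < E / A by positivity)
      rwa [inv_div] at this
    have h2 : 1 / E ≤ 1 - A / E := by
      rw [one_sub_div hE0.ne']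
      gcongr
    have h3 : 1 / (D * Y) ≤ 1 / E := one_div_le_one_div_of_le hE0 hED
    rw [Real.log_div hE0.ne' hA0.ne'] at h1
    rw [← sub_div, mul_comm q, ← div_div]
    gcongr
    linarith
  have hpos : 0 < 1 / (q * (D * Y)) := by positivity
  have hint := integrable_exp_mul_comp_exp (b := (n : ℝ) + 1) q hp (by positivity) hs
    fun y => abs_le.2 ⟨by linarith [hs₀ y], hs₁ y⟩
  refine le_trans ?_ (setIntegral_le_integral (s := Set.Icc (Real.log A / q) (Real.log E / q))
    hint (Eventually.of_forall fun x => mul_nonneg (Real.exp_pos _).le (hs₀ _)))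
  refine le_trans ?_ (setIntegral_ge_of_const_le_real
    (c := Real.exp (n / p * Real.log n - D * n) * (1 / 2)) measurableSet_Icc
    (by simp) (fun x hx => ?_) hint.integrableOn)
  · rw [Real.volume_real_Icc_of_le (by linarith)]
    gcongr
  · have hx1 : Real.log A ≤ q * x := by
      have := hx.1
      rwa [div_le_iff₀' hq] at this
    have hx2 : q * x ≤ Real.log E := by
      have := hx.2
      rwa [le_div_iff₀' hq] at this
    have hAx : A ≤ Real.exp (q * x) := (Real.log_le_iff_le_exp hA0).1 hx1
    have hEx : Real.exp (q * x) ≤ E := (Real.le_log_iff_exp_le hE0).1 hx2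
    have hxl : Real.log n / p ≤ x := by
      have h1 : q / p * Real.log n ≤ q * x :=
        ((Real.le_log_iff_exp_le hA0).2 hYA).trans hx1
      refine le_of_mul_le_mul_left ?_ hq
      calc q * (Real.log n / p) = q / p * Real.log n := by ring
        _ ≤ _ := h1
    have hx0 : 0 ≤ x := le_trans (by positivity) hxl
    have hxu : Real.exp (p * x) ≤ D * n := by
      have h1 : q * x ≤ Real.log D + q / p * Real.log n := by
        have := hx2.trans (Real.log_le_log hE0 hED)
        rwa [Real.log_mul (by linarith) (by linarith), hY, Real.log_exp] at this
      have h2 : p * x ≤ Real.log D + Real.log n := by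
        have hlD : 0 ≤ Real.log D := Real.log_nonneg hD1
        have h3 : p * x ≤ p / q * (Real.log D + q / p * Real.log n) := by
          calc p * x = p / q * (q * x) := by field_simp
            _ ≤ _ := by gcongr
        have h4 : p / q * (Real.log D + q / p * Real.log n) = p / q * Real.log D + Real.log n := by
          field_simp
        have h5 : p / q * Real.log D ≤ Real.log D :=
          mul_le_of_le_one_left hlD ((div_le_one hq).2 hpq.le)
        linarith
      rw [← Real.le_log_iff_exp_le (by positivity), Real.log_mul (by linarith) (by linarith)]
      exact h2
    have hmul : n / p * Real.log n ≤ n * x := by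
      calc n / p * Real.log n = n * (Real.log n / p) := by ring
        _ ≤ _ := by gcongr
    have := hs₂ k _ hAx hEx
    exact mul_le_mul (Real.exp_le_exp.2 (by linarith)) this (by norm_num) (Real.exp_pos _).le

/-! ### Superexponential decay on the scale `e^{-c n log n}` -/

theorem inv_factorial_le_exp {n : ℕ} (hn : 1 ≤ n) :
    (n.factorial : ℝ)⁻¹ ≤ Real.exp (n - n * Real.log n) := by
  have hn' : (0 : ℝ) < n := by exact_mod_cast hn
  have h := Real.pow_div_factorial_le_exp _ hn'.le n
  have h2 : (n : ℝ) ^ n = Real.exp (n * Real.log n) := by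
    rw [Real.exp_nat_mul, Real.exp_log hn']
  rw [Real.exp_sub, ← h2, le_div_iff₀ (by positivity), mul_comm, ← div_eq_mul_inv]
  exact h

theorem exp_le_inv_factorial {n : ℕ} (hn : 1 ≤ n) :
    Real.exp (-(n * Real.log n)) ≤ (n.factorial : ℝ)⁻¹ := by
  have hn' : (0 : ℝ) < n := by exact_mod_cast hn
  have h2 : (n : ℝ) ^ n = Real.exp (n * Real.log n) := by
    rw [Real.exp_nat_mul, Real.exp_log hn']
  rw [Real.exp_neg, ← h2]
  exact inv_anti₀ (by positivity) (by exact_mod_cast n.factorial_le_pow)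

theorem eventually_linear_le_mul_log {ε : ℝ} (hε : 0 < ε) (a b : ℝ) :
    ∀ᶠ n : ℕ in atTop, a * n + b ≤ ε * (n * Real.log n) := by
  have h : Tendsto (fun n : ℕ => ε * Real.log n) atTop atTop :=
    (Real.tendsto_log_atTop.comp tendsto_natCast_atTop_atTop).const_mul_atTop hε
  filter_upwards [h.eventually_ge_atTop (a + |b|), eventually_ge_atTop 1] with n hn hn1
  have hn' : (1 : ℝ) ≤ n := by exact_mod_cast hn1
  have h1 : n * (a + |b|) ≤ n * (ε * Real.log n) := by gcongr
  have h2 : |b| ≤ n * |b| := le_mul_of_one_le_left (abs_nonneg b) hn'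
  have h3 := le_abs_self b
  linarith

/-- The sequence `ν` is, up to factors `e^{o(n log n)}`, at most `e^{-c n log n}`. -/
def DecaysAtLeast (ν : ℕ → ℝ) (c : ℝ) : Prop :=
  ∀ c' < c, ∀ᶠ n : ℕ in atTop, |ν n| ≤ Real.exp (-(c' * (n * Real.log n)))

/-- The sequence `ν` is, up to factors `e^{o(n log n)}`, at least `e^{-c n log n}`. -/
def DecaysAtMost (ν : ℕ → ℝ) (c : ℝ) : Prop :=
  ∀ c' > c, ∀ᶠ n : ℕ in atTop, Real.exp (-(c' * (n * Real.log n))) ≤ |ν n|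

theorem decaysAtLeast_of_le_integral {ν : ℕ → ℝ} {a : ℝ} (ha : 0 < a)
    (h : ∀ n, |ν n| ≤ (n.factorial : ℝ)⁻¹ *
      ∫ x : ℝ, Real.exp ((n + 1) * x - Real.exp (a * x))) :
    DecaysAtLeast ν (1 - 1 / a) := by
  intro c' hc'
  set C : ℝ := ∫ x : ℝ, Real.exp (1 * x - 1 / 2 * Real.exp (a * x)) with hC
  have hC0 : 0 ≤ C := integral_nonneg fun x => (Real.exp_pos _).le
  have hε : 0 < 1 - 1 / a - c' := by linarith
  filter_upwards [eventually_linear_le_mul_log hε (1 - 1 / a * Real.log (a * (1 / 2))) C,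
    eventually_ge_atTop 1] with n hn hn1
  have hn' : (0 : ℝ) < n := by exact_mod_cast hn1
  calc |ν n| ≤ (n.factorial : ℝ)⁻¹ * ∫ x : ℝ, Real.exp ((n + 1) * x - Real.exp (a * x)) := h n
    _ ≤ Real.exp (n - n * Real.log n) *
        (Real.exp C * Real.exp (n / a * Real.log (n / (a * (1 / 2))))) := by
        refine mul_le_mul (inv_factorial_le_exp hn1) ((integral_exp_le ha hn1).trans ?_)
          (integral_nonneg fun x => (Real.exp_pos _).le) (Real.exp_pos _).le
        gcongr
        linarith [Real.add_one_le_exp C]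
    _ ≤ Real.exp (-(c' * (n * Real.log n))) := by
        rw [← Real.exp_add, ← Real.exp_add, Real.exp_le_exp,
          Real.log_div hn'.ne' (by positivity)]
        have e : (n : ℝ) - n * Real.log n + (C + n / a * (Real.log n - Real.log (a * (1 / 2)))) =
            (1 - 1 / a * Real.log (a * (1 / 2))) * n + C - (1 - 1 / a) * (n * Real.log n) := by
          ring
        rw [e]
        linarith

theorem decaysAtLeast_modulatedProfile {p : ℝ} (q : ℝ) (hp : 0 < p) {s : ℝ → ℝ}
    (hs₁ : ∀ y, |s y| ≤ 1) :
    DecaysAtLeast (radialEigenvalue (modulatedProfile p q s)) (1 - 1 / p) := by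
  refine decaysAtLeast_of_le_integral hp fun n => ?_
  rw [radialEigenvalue_modulatedProfile, abs_mul, abs_of_pos (by positivity)]
  gcongr
  exact abs_integral_exp_mul_comp_exp_le q hp (by positivity) hs₁

theorem decaysAtLeast_modulatedProfile_sin {p q : ℝ} (hp : 0 < p) (hpq : p < q) :
    DecaysAtLeast (radialEigenvalue (modulatedProfile p q Real.sin)) (1 - 1 / q) := by
  refine decaysAtLeast_of_le_integral (hp.trans hpq) fun n => ?_
  rw [radialEigenvalue_modulatedProfile, abs_mul, abs_of_pos (by positivity)]
  gcongr
  exact abs_integral_exp_mul_sin_le hp hpq (by positivity)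

theorem decaysAtMost_modulatedProfile {p q φ : ℝ} (hp : 0 < p) (hpq : p < q) (hφ : 0 ≤ φ)
    (hφ' : φ ≤ Real.pi) {s : ℝ → ℝ} (hs : Measurable s) (hs₀ : ∀ y, 0 ≤ s y) (hs₁ : ∀ y, s y ≤ 1)
    (hs₂ : ∀ (k : ℕ) (y : ℝ), 2 * Real.pi * k + φ + Real.pi / 6 ≤ y →
      y ≤ 2 * Real.pi * k + φ + 5 * Real.pi / 6 → 1 / 2 ≤ s y) :
    DecaysAtMost (radialEigenvalue (modulatedProfile p q s)) (1 - 1 / p) := by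
  intro c' hc'
  have hq : 0 < q := hp.trans hpq
  set D : ℝ := 1 + 4 * Real.pi with hD
  have hD0 : 0 < D := by positivity
  have hε : 0 < c' - (1 - 1 / p) := by linarith
  filter_upwards [eventually_linear_le_mul_log hε (D + q / p) (Real.log (2 * (q * D))),
    eventually_ge_atTop 1] with n hn hn1
  have hn' : (0 : ℝ) < n := by exact_mod_cast hn1
  rw [radialEigenvalue_modulatedProfile]
  refine le_trans ?_ (le_abs_self _)
  refine le_trans ?_ (mul_le_mul (exp_le_inv_factorial hn1)
    (le_integral_exp_mul_comp_exp hp hpq hφ hφ' hs hs₀ hs₁ hs₂ hn1) (by positivity) (by positivity))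
  rw [← hD]
  have e : Real.exp (-(n * Real.log n)) * (Real.exp (n / p * Real.log n - D * n) * (1 / 2) *
      (1 / (q * (D * Real.exp (q / p * Real.log n))))) =
      Real.exp (-(n * Real.log n) + (n / p * Real.log n - D * n) - Real.log (2 * (q * D)) -
        q / p * Real.log n) := by
    generalize (n : ℝ) / p * Real.log n - D * n = X
    rw [Real.exp_sub, Real.exp_sub, Real.exp_add, Real.exp_log (by positivity)]
    field_simp
  rw [e, Real.exp_le_exp]
  have hl : Real.log n ≤ n := (Real.log_le_self hn'.le)
  have hl2 : q / p * Real.log n ≤ q / p * n := by gcongr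
  have e2 : (n : ℝ) / p * Real.log n = 1 / p * (n * Real.log n) := by ring
  rw [e2]
  linarith

theorem DecaysAtLeast.tendsto_zero {ν : ℕ → ℝ} {c : ℝ} (hc : 0 < c) (h : DecaysAtLeast ν c) :
    Tendsto ν atTop (𝓝 0) := by
  refine squeeze_zero_norm' (h (c / 2) (by linarith)) (Real.tendsto_exp_neg_atTop_nhds_zero.comp ?_)
  refine Tendsto.const_mul_atTop (by positivity) ?_
  exact tendsto_natCast_atTop_atTop.atTop_mul_atTop₀
    (Real.tendsto_log_atTop.comp tendsto_natCast_atTop_atTop)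

/-! ### Counting functions -/

theorem tendsto_div_log_atTop : Tendsto (fun L : ℝ => L / Real.log L) atTop atTop := by
  have h := Real.isLittleO_log_id_atTop
  have h2 := h.tendsto_div_nhds_zero
  have h3 : Tendsto (fun L : ℝ => Real.log L / L) atTop (𝓝[>] 0) := by
    refine tendsto_nhdsWithin_iff.2 ⟨h2, ?_⟩
    filter_upwards [eventually_gt_atTop 1] with L hL
    exact div_pos (Real.log_pos hL) (by linarith)
  refine h3.inv_tendsto_nhdsGT_zero.congr fun L => ?_
  simp

theorem tendsto_abs_log_nhdsGT_zero : Tendsto (fun t : ℝ => |Real.log t|) (𝓝[>] 0) atTop :=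
  tendsto_abs_atBot_atTop.comp Real.tendsto_log_nhdsGT_zero

theorem eventually_nhdsGT_zero_of_atTop {P : ℝ → ℝ → Prop}
    (h : ∀ᶠ L in atTop, P (Real.exp (-L)) L) : ∀ᶠ t in 𝓝[>] (0 : ℝ), P t |Real.log t| := by
  filter_upwards [tendsto_abs_log_nhdsGT_zero.eventually h, Ioo_mem_nhdsGT one_pos] with t ht ht1
  have : Real.exp (-|Real.log t|) = t := by
    rw [abs_of_neg (Real.log_neg ht1.1 ht1.2), neg_neg, Real.exp_log ht1.1]
  rwa [this] at ht

theorem DecaysAtLeast.eventually_ncard_le {ν : ℕ → ℝ} {c : ℝ} (hc : 0 < c)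
    (h : DecaysAtLeast ν c) {K : ℝ} (hK : 1 / c < K) :
    ∀ᶠ t in 𝓝[>] (0 : ℝ),
      ({n | t < |ν n|}.ncard : ℝ) ≤ K * (|Real.log t| / Real.log |Real.log t|) := by
  refine eventually_nhdsGT_zero_of_atTop (P := fun t L =>
    ({n | t < |ν n|}.ncard : ℝ) ≤ K * (L / Real.log L)) ?_
  obtain ⟨K', hK1, hK2⟩ := exists_between hK
  have hK'0 : 0 < K' := lt_trans (by positivity) hK1
  obtain ⟨c', hc1, hc2⟩ := exists_between (show 1 / K' < c by
    rwa [one_div_lt hK'0 hc])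
  have hc'0 : 0 < c' := lt_trans (by positivity) hc1
  have hcK : 1 < c' * K' := by rwa [div_lt_iff₀ hK'0] at hc1
  obtain ⟨n₀, hn₀⟩ := eventually_atTop.1 (h c' hc2)
  have hM := tendsto_div_log_atTop.const_mul_atTop hK'0
  have hrest := tendsto_div_log_atTop.const_mul_atTop (sub_pos.2 hK2)
  have hloglog : ∀ᶠ L : ℝ in atTop, Real.log (Real.log L) - Real.log K' ≤
      (1 - 1 / (c' * K')) * Real.log L := by
    have h0 : 0 < 1 - 1 / (c' * K') := by
      rw [sub_pos, div_lt_one (by linarith)]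
      exact hcK
    have h1 := (Real.isLittleO_log_id_atTop.comp_tendsto Real.tendsto_log_atTop).bound (half_pos h0)
    filter_upwards [h1, (Real.tendsto_log_atTop.const_mul_atTop (half_pos h0)).eventually_ge_atTop
      (-Real.log K'), eventually_gt_atTop 1] with L hL hL2 hL3
    simp only [Function.comp_apply, id, Real.norm_eq_abs, abs_of_pos (Real.log_pos hL3)] at hL
    have := (le_abs_self _).trans hL
    linarith
  filter_upwards [hM.eventually_ge_atTop 1, hrest.eventually_ge_atTop (n₀ + 1), hloglog,
    eventually_gt_atTop 1] with L hL1 hL2 hL3 hL4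
  set M : ℝ := K' * (L / Real.log L) with hMdef
  have hlL : 0 < Real.log L := Real.log_pos hL4
  have hL0 : 0 < L := by linarith
  have hlogM : Real.log M = Real.log K' + Real.log L - Real.log (Real.log L) := by
    rw [hMdef, Real.log_mul hK'0.ne' (by positivity), Real.log_div hL0.ne' hlL.ne']
    ring
  have hML : L ≤ c' * (M * Real.log M) := by
    have h1 : Real.log L / (c' * K') ≤ Real.log M := by
      rw [hlogM, div_eq_mul_one_div, mul_comm]
      linarith
    calc L = c' * (M * (Real.log L / (c' * K'))) := by
          rw [hMdef]
          field_simp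
      _ ≤ _ := by gcongr
  have hsub : {n | Real.exp (-L) < |ν n|} ⊆ (Finset.range (n₀ + (⌊M⌋₊ + 1)) : Set ℕ) := by
    intro n hn
    rw [Finset.coe_range, Set.mem_Iio]
    by_contra! hcon
    have hnM : M ≤ n := by
      have h1 := (Nat.lt_floor_add_one M).le
      have h2 : ((⌊M⌋₊ + 1 : ℕ) : ℝ) ≤ n := by exact_mod_cast le_trans (Nat.le_add_left _ _) hcon
      push_cast at h2
      linarith
    have h1 := hn₀ n (by omega)
    have h2 : M * Real.log M ≤ n * Real.log n :=
      mul_le_mul hnM (Real.log_le_log (by linarith) hnM) (Real.log_nonneg hL1) (by positivity)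
    have h3 : Real.exp (-(c' * (n * Real.log n))) ≤ Real.exp (-L) := by
      rw [Real.exp_le_exp]
      have : c' * (M * Real.log M) ≤ c' * (n * Real.log n) := by gcongr
      linarith
    exact absurd hn (not_lt.2 (h1.trans h3))
  have hcard := Set.ncard_le_ncard hsub (Finset.finite_toSet _)
  rw [Set.ncard_coe_finset, Finset.card_range] at hcard
  have h1 : ({n | Real.exp (-L) < |ν n|}.ncard : ℝ) ≤ n₀ + (⌊M⌋₊ + 1) := by exact_mod_cast hcard
  have h2 := Nat.floor_le (show 0 ≤ M by linarith)
  have h3 : (K - K') * (L / Real.log L) = K * (L / Real.log L) - M := by rw [hMdef]; ring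
  linarith

theorem DecaysAtMost.eventually_le_ncard {ν : ℕ → ℝ} {c : ℝ} (hc : 0 < c)
    (h : DecaysAtMost ν c) (hν : Tendsto ν atTop (𝓝 0)) {K : ℝ} (hK : K < 1 / c) :
    ∀ᶠ t in 𝓝[>] (0 : ℝ),
      K * (|Real.log t| / Real.log |Real.log t|) ≤ ({n | t < |ν n|}.ncard : ℝ) := by
  refine eventually_nhdsGT_zero_of_atTop (P := fun t L =>
    K * (L / Real.log L) ≤ ({n | t < |ν n|}.ncard : ℝ)) ?_
  obtain ⟨K', hK1, hK2⟩ := exists_between (max_lt hK (show 0 < 1 / c by positivity))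
  have hK'0 : 0 < K' := (le_max_right _ _).trans_lt hK1
  have hKK' : K < K' := (le_max_left _ _).trans_lt hK1
  obtain ⟨c', hc1, hc2⟩ := exists_between (show c < 1 / K' by rwa [lt_one_div hc hK'0])
  have hc'0 : 0 < c' := hc.trans hc1
  have hcK : c' * K' < 1 := by rwa [lt_div_iff₀ hK'0] at hc2
  obtain ⟨n₀, hn₀⟩ := eventually_atTop.1 (h c' hc1)
  have hrest := tendsto_div_log_atTop.const_mul_atTop (sub_pos.2 hKK')
  filter_upwards [hrest.eventually_ge_atTop (n₀ + 1),
    Real.tendsto_log_atTop.eventually_ge_atTop K', eventually_gt_atTop 1] with L hL2 hL3 hL4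
  set M : ℝ := K' * (L / Real.log L) with hMdef
  have hlL : 0 < Real.log L := Real.log_pos hL4
  have hL0 : 0 < L := by linarith
  have hM0 : 0 < M := by positivity
  have hML : M ≤ L := by
    rw [hMdef, ← mul_div_assoc, div_le_iff₀ hlL, mul_comm]
    gcongr
  have hfin : {n | Real.exp (-L) < |ν n|}.Finite := by
    have h := hν.abs.eventually (gt_mem_nhds (show |(0 : ℝ)| < Real.exp (-L) by
      simpa using Real.exp_pos (-L)))
    rw [← Nat.cofinite_eq_atTop] at h
    exact (eventually_cofinite.1 h).subset fun n hn => not_lt.2 (le_of_lt hn)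
  have hsub : (Finset.Ioc n₀ ⌊M⌋₊ : Set ℕ) ⊆ {n | Real.exp (-L) < |ν n|} := by
    intro n hn
    rw [Finset.coe_Ioc, Set.mem_Ioc] at hn
    have hn1 : (1 : ℝ) ≤ n := by exact_mod_cast (Nat.zero_le _).trans_lt hn.1
    have hnM : (n : ℝ) ≤ M := (Nat.le_floor_iff hM0.le).1 hn.2
    refine lt_of_lt_of_le ?_ (hn₀ n hn.1.le)
    rw [Real.exp_lt_exp, neg_lt_neg_iff]
    have hlog : Real.log n ≤ Real.log L := Real.log_le_log (by linarith) (hnM.trans hML)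
    calc c' * (n * Real.log n) ≤ c' * (M * Real.log L) := by
          gcongr
      _ = c' * K' * L := by
          rw [hMdef]
          field_simp
      _ < 1 * L := by gcongr
      _ = L := one_mul L
  have hcard := Set.ncard_le_ncard hsub hfin
  rw [Set.ncard_coe_finset, Nat.card_Ioc] at hcard
  have h1 : (⌊M⌋₊ : ℝ) - n₀ ≤ ({n | Real.exp (-L) < |ν n|}.ncard : ℝ) := by
    have : (⌊M⌋₊ : ℝ) ≤ ({n | Real.exp (-L) < |ν n|}.ncard : ℝ) + n₀ := by
      exact_mod_cast Nat.sub_le_iff_le_add.1 hcard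
    linarith
  have h2 := (Nat.lt_floor_add_one M).le
  have h3 : (K' - K) * (L / Real.log L) = M - K * (L / Real.log L) := by rw [hMdef]; ring
  linarith

/-! ### Spectra of radial Toeplitz operators -/

theorem inner_monomialBasis_toeplitz_of_radial {w : ℝ → ℝ} (hw : Measurable w) {V : ℂ → ℝ}
    (hV : MemLp (fun z => (V z : ℂ)) ∞ gaussian) (hVw : V = fun z => w ‖z‖) (n : ℕ) (u : space) :
    inner ℂ (monomialBasis n) (toeplitz V hV u) =
      radialEigenvalue w n * inner ℂ (monomialBasis n) u := by
  subst hVw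
  exact inner_monomialBasis_toeplitz hw hV n u

section Radial

variable {w : ℝ → ℝ} {V : ℂ → ℝ} {hV : MemLp (fun z => (V z : ℂ)) ∞ gaussian}

theorem count_toeplitz (hw : Measurable w) (hVw : V = fun z => w ‖z‖)
    (hν : Tendsto (radialEigenvalue w) atTop (𝓝 0)) {t : ℝ} (ht : 0 < t) :
    count (toeplitz V hV) t = ({n | t < |radialEigenvalue w n|}.ncard : ℝ≥0∞) :=
  HilbertBasis.count_eq_ncard (inner_monomialBasis_toeplitz_of_radial hw hV hVw) hν ht

theorem toeplitz_compact_selfAdjoint_count_ne_top (hw : Measurable w) (hVw : V = fun z => w ‖z‖)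
    (hν : Tendsto (radialEigenvalue w) atTop (𝓝 0)) :
    IsCompactOperator (toeplitz V hV) ∧ IsSelfAdjoint (toeplitz V hV) ∧
      ∀ t : ℝ, 0 < t → count (toeplitz V hV) t ≠ ⊤ :=
  ⟨HilbertBasis.isCompactOperator_of_diagonal
      (inner_monomialBasis_toeplitz_of_radial hw hV hVw) hν,
    isSelfAdjoint_toeplitz V hV, fun t ht => by
      rw [count_toeplitz hw hVw hν ht]
      exact ENNReal.natCast_ne_top _⟩

theorem limsup_count_toeplitz_le (hw : Measurable w) (hVw : V = fun z => w ‖z‖) {c : ℝ}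
    (hc : 0 < c) (h : DecaysAtLeast (radialEigenvalue w) c) :
    limsup (fun t : ℝ => count (toeplitz V hV) t *
      ENNReal.ofReal (Real.log |Real.log t| / |Real.log t|)) (𝓝[>] 0) ≤ ENNReal.ofReal (1 / c) := by
  have hbound : ∀ K, 1 / c < K → limsup (fun t : ℝ => count (toeplitz V hV) t *
      ENNReal.ofReal (Real.log |Real.log t| / |Real.log t|)) (𝓝[>] 0) ≤ ENNReal.ofReal K := by
    intro K hK
    refine limsup_le_of_le (by isBoundedDefault) ?_
    filter_upwards [h.eventually_ncard_le hc hK, self_mem_nhdsWithin,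
      tendsto_abs_log_nhdsGT_zero.eventually_gt_atTop 1] with t ht ht0 ht1
    have hll : 0 < Real.log |Real.log t| := Real.log_pos ht1
    rw [count_toeplitz hw hVw (h.tendsto_zero hc) ht0, ← ENNReal.ofReal_natCast,
      ← ENNReal.ofReal_mul (Nat.cast_nonneg _)]
    refine ENNReal.ofReal_le_ofReal ?_
    calc _ ≤ K * (|Real.log t| / Real.log |Real.log t|) *
          (Real.log |Real.log t| / |Real.log t|) := by gcongr
      _ = K := by field_simp
  refine ge_of_tendsto (x := 𝓝[>] (1 / c)) (f := ENNReal.ofReal)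
    (ENNReal.continuous_ofReal.continuousAt.mono_left nhdsWithin_le_nhds) ?_
  filter_upwards [self_mem_nhdsWithin] with K hK using hbound K hK

theorem isEquivalent_count_toeplitz (hw : Measurable w) (hVw : V = fun z => w ‖z‖) {c : ℝ}
    (hc : 0 < c) (h : DecaysAtLeast (radialEigenvalue w) c)
    (h' : DecaysAtMost (radialEigenvalue w) c) :
    Asymptotics.IsEquivalent (𝓝[>] (0 : ℝ)) (fun t => (count (toeplitz V hV) t).toReal)
      (fun t => 1 / c * (|Real.log t| / Real.log |Real.log t|)) := by
  have hν := h.tendsto_zero hc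
  have hcount : ∀ t : ℝ, 0 < t → (count (toeplitz V hV) t).toReal =
      ({n | t < |radialEigenvalue w n|}.ncard : ℝ) := fun t ht => by
    rw [count_toeplitz hw hVw hν ht, ENNReal.toReal_natCast]
  have hg : ∀ᶠ t in 𝓝[>] (0 : ℝ), 0 < |Real.log t| / Real.log |Real.log t| := by
    filter_upwards [tendsto_abs_log_nhdsGT_zero.eventually_gt_atTop 1] with t ht1
    exact div_pos (by linarith) (Real.log_pos ht1)
  refine Asymptotics.isEquivalent_of_tendsto_one ?_
  have key : Tendsto (fun t => (count (toeplitz V hV) t).toReal /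
      (|Real.log t| / Real.log |Real.log t|)) (𝓝[>] 0) (𝓝 (1 / c)) := by
    refine tendsto_order.2 ⟨fun a ha => ?_, fun a ha => ?_⟩
    · obtain ⟨K, hK1, hK2⟩ := exists_between ha
      filter_upwards [h'.eventually_le_ncard hc hν hK2, hg, self_mem_nhdsWithin] with t ht htg ht0
      rw [hcount t ht0]
      exact hK1.trans_le ((le_div_iff₀ htg).2 ht)
    · obtain ⟨K, hK1, hK2⟩ := exists_between ha
      filter_upwards [h.eventually_ncard_le hc hK1, hg, self_mem_nhdsWithin] with t ht htg ht0
      rw [hcount t ht0]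
      exact ((div_le_iff₀ htg).2 ht).trans_lt hK2
  have h1 := key.div_const (1 / c)
  rw [div_self (one_div_pos.2 hc).ne'] at h1
  refine h1.congr fun t => ?_
  rw [Pi.div_apply, div_div, mul_comm (1 / c)]

end Radial

/-! ### The oscillating factors -/

theorem one_half_le_sin {x : ℝ} (h₁ : Real.pi / 6 ≤ x) (h₂ : x ≤ 5 * Real.pi / 6) :
    1 / 2 ≤ Real.sin x := by
  rw [← Real.sin_pi_div_six]
  rcases le_total x (Real.pi / 2) with h | h
  · exact Real.sin_le_sin_of_le_of_le_pi_div_two (by linarith [Real.pi_pos]) h h₁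
  · rw [← Real.sin_pi_sub x]
    exact Real.sin_le_sin_of_le_of_le_pi_div_two (by linarith [Real.pi_pos]) (by linarith)
      (by linarith)

theorem one_half_le_sin_of_mem {k : ℕ} {y : ℝ} (h₁ : 2 * Real.pi * k + 0 + Real.pi / 6 ≤ y)
    (h₂ : y ≤ 2 * Real.pi * k + 0 + 5 * Real.pi / 6) : 1 / 2 ≤ Real.sin y := by
  rw [← Real.sin_sub_nat_mul_two_pi y k]
  exact one_half_le_sin (by linarith) (by linarith)

theorem one_half_le_neg_sin_of_mem {k : ℕ} {y : ℝ}
    (h₁ : 2 * Real.pi * k + Real.pi + Real.pi / 6 ≤ y)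
    (h₂ : y ≤ 2 * Real.pi * k + Real.pi + 5 * Real.pi / 6) : 1 / 2 ≤ -Real.sin y := by
  rw [← Real.sin_sub_pi, ← Real.sin_sub_nat_mul_two_pi (y - Real.pi) k]
  exact one_half_le_sin (by linarith) (by linarith)

theorem symbol_eq (p q : ℝ) : symbol p q = fun z => modulatedProfile p q Real.sin ‖z‖ := rfl

theorem symbolAbs_eq (p q : ℝ) :
    symbolAbs p q = fun z => modulatedProfile p q (fun y => |Real.sin y|) ‖z‖ := by
  ext z
  rw [symbolAbs, symbol, profile, modulatedProfile, abs_mul, abs_of_pos (Real.exp_pos _)]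

theorem symbolPos_eq (p q : ℝ) :
    symbolPos p q = fun z => modulatedProfile p q (fun y => max (Real.sin y) 0) ‖z‖ := by
  ext z
  rw [symbolPos, symbol, profile, modulatedProfile, mul_max_of_nonneg _ _ (Real.exp_pos _).le,
    mul_zero]

theorem symbolNeg_eq (p q : ℝ) :
    symbolNeg p q = fun z => modulatedProfile p q (fun y => max (-Real.sin y) 0) ‖z‖ := by
  ext z
  rw [symbolNeg, symbol, profile, modulatedProfile, mul_max_of_nonneg _ _ (Real.exp_pos _).le,
    mul_zero, mul_neg]

end Bargmann

open Bargmann in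
theorem mainTheorem3 (p q : ℝ) (hp : 1 < p) (hpq : p < q)
    (T Tabs Tpos Tneg : Bargmann.space →L[ℂ] Bargmann.space)
    (hT : T = Bargmann.toeplitz (Bargmann.symbol p q) (Bargmann.memLp_symbol hp q))
    (hTabs : Tabs = Bargmann.toeplitz (Bargmann.symbolAbs p q) (Bargmann.memLp_symbolAbs hp q))
    (hTpos : Tpos = Bargmann.toeplitz (Bargmann.symbolPos p q) (Bargmann.memLp_symbolPos hp q))
    (hTneg : Tneg = Bargmann.toeplitz (Bargmann.symbolNeg p q) (Bargmann.memLp_symbolNeg hp q)) :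
    -- the four operators are compact and self-adjoint, with finite counting functions
    (∀ S ∈ [T, Tabs, Tpos, Tneg],
      IsCompactOperator S ∧ IsSelfAdjoint S ∧ ∀ t : ℝ, 0 < t → Bargmann.count S t ≠ ⊤) ∧
    limsup (fun t : ℝ => Bargmann.count T t * ENNReal.ofReal (Real.log |Real.log t| / |Real.log t|))
        (𝓝[>] 0) ≤ ENNReal.ofReal (q / (q - 1)) ∧
    Asymptotics.IsEquivalent (𝓝[>] (0 : ℝ))
      (fun t => (Bargmann.count Tabs t).toReal) (fun t => (Bargmann.count Tpos t).toReal) ∧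
    Asymptotics.IsEquivalent (𝓝[>] (0 : ℝ))
      (fun t => (Bargmann.count Tpos t).toReal) (fun t => (Bargmann.count Tneg t).toReal) ∧
    Asymptotics.IsEquivalent (𝓝[>] (0 : ℝ))
      (fun t => (Bargmann.count Tneg t).toReal)
      (fun t => p / (p - 1) * (|Real.log t| / Real.log |Real.log t|)) := by
  have hp0 : 0 < p := one_pos.trans hp
  have hq1 : 1 < q := hp.trans hpq
  have hconst : ∀ a : ℝ, 1 < a → 0 < 1 - 1 / a ∧ 1 / (1 - 1 / a) = a / (a - 1) := by
    intro a ha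
    have h1 : 0 < a - 1 := by linarith
    have h2 : 1 - 1 / a = (a - 1) / a := by field_simp
    rw [h2]
    exact ⟨by positivity, one_div_div _ _⟩
  obtain ⟨hcp, hcp'⟩ := hconst p hp
  obtain ⟨hcq, hcq'⟩ := hconst q hq1
  rw [← hcp', ← hcq']
  have hsabs : ∀ y : ℝ, |(|Real.sin y|)| ≤ 1 := fun y => by
    rw [abs_abs]
    exact Real.abs_sin_le_one y
  have hspos : ∀ y : ℝ, |max (Real.sin y) 0| ≤ 1 := fun y => by
    rw [abs_of_nonneg (le_max_right _ _)]
    exact max_le (Real.sin_le_one y) zero_le_one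
  have hsneg : ∀ y : ℝ, |max (-Real.sin y) 0| ≤ 1 := fun y => by
    rw [abs_of_nonneg (le_max_right _ _)]
    exact max_le (by linarith [Real.neg_one_le_sin y]) zero_le_one
  have mabs : Measurable fun y : ℝ => |Real.sin y| := by fun_prop
  have mpos : Measurable fun y : ℝ => max (Real.sin y) 0 := by fun_prop
  have mneg : Measurable fun y : ℝ => max (-Real.sin y) 0 := by fun_prop
  have dsin := decaysAtLeast_modulatedProfile_sin hp0 hpq
  have dabs := decaysAtLeast_modulatedProfile q hp0 hsabs
  have dpos := decaysAtLeast_modulatedProfile q hp0 hspos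
  have dneg := decaysAtLeast_modulatedProfile q hp0 hsneg
  have eabs := isEquivalent_count_toeplitz (hV := memLp_symbolAbs hp q)
    (measurable_modulatedProfile p q mabs) (symbolAbs_eq p q) hcp dabs <|
    decaysAtMost_modulatedProfile hp0 hpq le_rfl Real.pi_pos.le mabs (fun y => abs_nonneg _)
      Real.abs_sin_le_one fun k y h₁ h₂ => (one_half_le_sin_of_mem h₁ h₂).trans (le_abs_self _)
  have epos := isEquivalent_count_toeplitz (hV := memLp_symbolPos hp q)
    (measurable_modulatedProfile p q mpos) (symbolPos_eq p q) hcp dpos <|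
    decaysAtMost_modulatedProfile hp0 hpq le_rfl Real.pi_pos.le mpos (fun y => le_max_right _ _)
      (fun y => (le_abs_self _).trans (hspos y))
      fun k y h₁ h₂ => (one_half_le_sin_of_mem h₁ h₂).trans (le_max_left _ _)
  have eneg := isEquivalent_count_toeplitz (hV := memLp_symbolNeg hp q)
    (measurable_modulatedProfile p q mneg) (symbolNeg_eq p q) hcp dneg <|
    decaysAtMost_modulatedProfile hp0 hpq Real.pi_pos.le le_rfl mneg (fun y => le_max_right _ _)
      (fun y => (le_abs_self _).trans (hsneg y))
      fun k y h₁ h₂ => (one_half_le_neg_sin_of_mem h₁ h₂).trans (le_max_left _ _)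
  subst hT hTabs hTpos hTneg
  refine ⟨?_, limsup_count_toeplitz_le (measurable_modulatedProfile p q Real.measurable_sin)
    (symbol_eq p q) hcq dsin, eabs.trans epos.symm, epos.trans eneg.symm, eneg⟩
  simp only [List.forall_mem_cons, List.not_mem_nil, false_imp_iff, implies_true, and_true]
  exact ⟨toeplitz_compact_selfAdjoint_count_ne_top
      (measurable_modulatedProfile p q Real.measurable_sin) (symbol_eq p q) (dsin.tendsto_zero hcq),
    toeplitz_compact_selfAdjoint_count_ne_top
      (measurable_modulatedProfile p q mabs) (symbolAbs_eq p q) (dabs.tendsto_zero hcp),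
    toeplitz_compact_selfAdjoint_count_ne_top
      (measurable_modulatedProfile p q mpos) (symbolPos_eq p q) (dpos.tendsto_zero hcp),
    toeplitz_compact_selfAdjoint_count_ne_top
      (measurable_modulatedProfile p q mneg) (symbolNeg_eq p q) (dneg.tendsto_zero hcp)⟩
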